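/- Let $k$ be a field, $R$ a commutative $k$-algebra, $\mathfrak D=\mathrm{Der}_k(R)$, and $\mathfrak S\subseteq\mathfrak D$ a subset. **Definitions.** An *$R/k$-algebra* is a $k$-algebra $B$ in which $R$ is embedded; it is viewed as a left $R$-module, $B\otimes_R B$ is formed with the left $R$-module structures, and $B\otimes_{\mathrm r}B$ is the quotient of $B\otimes_kB$ by the relations $br\otimes c=b\otimes rc$. An *$R/k$-bialgebra* is an $R/k$-algebra $B$ with $R$-linear maps $\Delta:B\to B\otimes_RB$, $\epsilon:B\to R$ that make $B$ an $R$-coalgebra, such that $\Delta(1)=1\otimes1$, $\Delta(bc)=\sum_{i,j} b_ic_j\otimes b_i'c_j'$ for all representations $\Delta(b)=\sum_i b_i\otimes b_i'$, $\Delta(c)=\sum_j c_j\otimes c_j'$, $\epsilon(1)=1$ and $\epsilon(bc)=\epsilon(b\,\epsilon(c))$. It is an *$R/k$-Hopf algebra* if there is a $k$-linear $E:B\to B\otimes_{\mathrm r}B$ with $E(rb)=rE(b)=E(b)r$, $\sum E(b_{(1)})b_{(2)}=b\otimes1$, $(I\otimes_R E)\Delta(b)=(\Delta\otimes_{\mathrm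 r}I)E(b)$ and $\mu(E(b))=\epsilon(b)1$ for all $b\in B$, $r\in R$, where $\mu$ is induced by multiplication. An *$R/k$-bialgebra homomorphism* is a $k$-algebra homomorphism that is the identity on $R$ and respects $\Delta$ and $\epsilon$. If $R$ is a module algebra over a $k$-bialgebra $H$ (an $H$-module with $h\cdot(rs)=\sum(h_{(1)}\cdot r)(h_{(2)}\cdot s)$, $h\cdot1=\epsilon(h)1$), the *smash product* $R\rtimes H$ is $R\otimes_kH$ with product $(r\# h)(s\# g)=\sum r(h_{(1)}\cdot s)\# h_{(2)}g$, embedding $r\mapsto r\#1$, and the $R$-coalgebra structure extended from $H$. $\mathrm{Diff}_k(\mathfrak S)$ is the subalgebra of the universal enveloping algebra $U(\mathfrak D)$ generated by $\mathfrak S$, with the bialgebra structure in which derivations are primitive and with its natural action on $R$. $k\mathcal{LT}(\mathfrak S)$ is the vector space with basis the ordered rooted trees whose non-root nodes are labeled by elements of $\mathfrak S$. In it $T_1\cdot T_2=\sum_dT_d$, where $d$ runs over all maps from the set of children of the root of $T_1$ to the set of nodes of $T_2$, and $T_d$ is obtained by linking each such child $c$ (with everything below it) to the node $d(c)$, the new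 children of a node preceding the old ones and all orders being preserved; $\Delta(T)=\sum_XT_X\otimes T_{X^c}$ over all subsets $X$ of the set of children of the root of $T$, where $T_X$ is the tree in which only the children in $X$ (with everything below them) are kept; $\epsilon(T)$ is $1$ if $T$ is the one-node tree and $0$ otherwise. Let $\mathrm v(E)$ be the tree with one non-root node, labeled $E$; let $\mathrm u(E;T_1,\dots,T_n)$, where the roots of the $T_i$ have one child each, be the tree whose root has one child, labeled $E$, with which the roots of $T_1,\dots,T_n$ are identified (in this order); and let $\mathrm t(T_1,\dots,T_n)$ be the tree obtained by identifying the roots of $T_1,\dots,T_n$. A *connection* is a biadditive map $\nabla:\mathfrak D\times\mathfrak D\to\mathfrak D$, $(E,F)\mapsto\nabla_EF$, with $\nabla_{fE}F=f\nabla_EF$ and $\nabla_E(fF)=f\nabla_EF+E(f)F$ for $f\in R$. Given a connection, put $\nabla^0E=E$, $\nabla^{n+1}_{F_1,\dots,F_{n+1}}E=\nabla_{F_1}\nabla^n_{F_2,\dots,F_{n+1}}E-\sum_{l=2}^{n+1}\nabla^n_{F_2,\dots,\nabla_{F_1}F_l,\dots,F_{n+1}}E$, and likewise in $U(\mathfrak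 D)$ put $P_0=1$, $P_{n+1}(F_1,\dots,F_{n+1})=F_1P_n(F_2,\dots,F_{n+1})-\sum_{l=2}^{n+1}P_n(F_2,\dots,\nabla_{F_1}F_l,\dots,F_{n+1})$. Define recursively the derivation $\delta(\mathrm u(E;T_1,\dots,T_n))=\nabla^n_{\delta(T_1),\dots,\delta(T_n)}E$ (so $\delta(\mathrm v(E))=E$), and let $\Phi_\nabla:k\mathcal{LT}(\mathfrak S)\to U(\mathfrak D)$ be the linear map with $\Phi_\nabla(\mathrm t(T_1,\dots,T_n))=P_n(\delta(T_1),\dots,\delta(T_n))$ for all trees $T_i$ whose root has one child. The tree $T$ acts on $R$ as $\Phi_\nabla(T)$. **Theorem.** 1. $R\rtimes\mathrm{Diff}_k(\mathfrak S)$ is an $R/k$-Hopf algebra. The map $r\# h\mapsto(s\mapsto r(h\cdot s))$ is an $R/k$-algebra homomorphism $R\rtimes\mathrm{Diff}_k(\mathfrak S)\to\mathrm{End}_k(R)$ whose image is the subalgebra generated by the multiplications by elements of $R$ and by $\mathfrak S$; the image of $1\#\mathrm{Diff}_k(\mathfrak S)$ is the $k$-subalgebra generated by $\mathfrak S$. 2.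 For every $k\mathcal{LT}(\mathfrak S)$-module algebra structure on $R$, the smash product $R\rtimes k\mathcal{LT}(\mathfrak S)$ is an $R/k$-Hopf algebra. 3. (a) There is a bialgebra homomorphism $\varphi:k\mathcal{LT}(\mathfrak S)\to\mathrm{Diff}_k(\mathfrak S)$ with $\varphi(\mathrm v(E))=E$ for all $E\in\mathfrak S$. For every bialgebra homomorphism $\varphi:k\mathcal{LT}(\mathfrak S)\to\mathrm{Diff}_k(\mathfrak S)$, letting $k\mathcal{LT}(\mathfrak S)$ act on $R$ through $\varphi$ makes $R$ a module algebra, and $r\# T\mapsto r\#\varphi(T)$ is an $R/k$-bialgebra homomorphism $R\rtimes k\mathcal{LT}(\mathfrak S)\to R\rtimes\mathrm{Diff}_k(\mathfrak S)$. (b) For every connection $\nabla$ on $\mathfrak D$, the action of $k\mathcal{LT}(\mathfrak S)$ on $R$ through $\Phi_\nabla$ makes $R$ a module algebra. For every $\mathfrak S'\subseteq\mathfrak D$ with $\Phi_\nabla(k\mathcal{LT}(\mathfrak S))\subseteq\mathrm{Diff}_k(\mathfrak S')$ (that is, whenever the following map is defined), $\Phi_\nabla:k\mathcal{LT}(\mathfrak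 S)\to\mathrm{Diff}_k(\mathfrak S')$ is a bialgebra homomorphism and $r\# T\mapsto r\#\Phi_\nabla(T)$ is an $R/k$-bialgebra homomorphism $R\rtimes k\mathcal{LT}(\mathfrak S)\to R\rtimes\mathrm{Diff}_k(\mathfrak S')$. The inclusion $\Phi_\nabla(k\mathcal{LT}(\mathfrak S))\subseteq\mathrm{Diff}_k(\mathfrak S')$ holds whenever $\mathfrak S\subseteq\mathfrak S'$ and $\nabla_EF\in\mathrm{span}_k\mathfrak S'$ for all $E,F\in\mathfrak S'$; in particular for $\mathfrak S'=\mathfrak D$, and for $\mathfrak S'=\mathfrak S$ if the span of $\mathfrak S$ is closed under $\nabla$. -/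

import Mathlib

open scoped TensorProduct

noncomputable section

namespace TreeHopf

universe u v w

/-! ## `R/k`-algebras, `R/k`-bialgebras and `R/k`-Hopf algebras -/

/-- The operations of an `R/k`-bialgebra on a module `B` (a multiplication, the map from `R`,
a coproduct into the tensor product of left `R`-modules and a counit), without any laws.
The unit of `B` is the image of `1`. -/
structure RkData (k : Type u) (R : Type v) (B : Type w) [Field k] [CommRing R] [Algebra k R]
    [AddCommGroup B] [Module k B] [Module R B] [IsScalarTower k R B] where
  mul : B →ₗ[k] B →ₗ[k] B
  incl : R →ₗ[k] B
  comul : B →ₗ[R] B ⊗[R] B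
  counit : B →ₗ[R] R

section Rk

variable {k : Type u} {R : Type v} {B : Type w} [Field k] [CommRing R] [Algebra k R]
  [AddCommGroup B] [Module k B] [Module R B] [IsScalarTower k R B]

/-- `B` is a `k`-algebra in which `R` is embedded, and the `R`-module structure of `B` is left
multiplication by elements of `R`. -/
structure IsRkAlgebra (A : RkData k R B) : Prop where
  mul_assoc : ∀ a b c, A.mul (A.mul a b) c = A.mul a (A.mul b c)
  one_mul : ∀ b, A.mul (A.incl 1) b = b
  mul_one : ∀ b, A.mul b (A.incl 1) = b
  incl_mul : ∀ r s, A.incl (r * s) = A.mul (A.incl r) (A.incl s)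
  incl_injective : Function.Injective A.incl
  smul_eq : ∀ (r : R) (b : B), r • b = A.mul (A.incl r) b

/-- `R/k`-bialgebras. -/
structure IsRkBialgebra (A : RkData k R B) : Prop extends IsRkAlgebra A where
  coassoc : (TensorProduct.assoc R B B B).toLinearMap ∘ₗ A.comul.rTensor B ∘ₗ A.comul =
    A.comul.lTensor B ∘ₗ A.comul
  counit_left : A.counit.rTensor B ∘ₗ A.comul = TensorProduct.mk R R B 1
  counit_right : A.counit.lTensor B ∘ₗ A.comul = (TensorProduct.mk R B R).flip 1
  comul_one : A.comul (A.incl 1) = A.incl 1 ⊗ₜ[R] A.incl 1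
  /-- `Δ(bc) = Δ(b)Δ(c)`, for any representations of `Δ(b)` and `Δ(c)`. -/
  comul_mul : ∀ (b c : B) (n m : ℕ) (x x' : Fin n → B) (y y' : Fin m → B),
    A.comul b = ∑ i, x i ⊗ₜ[R] x' i → A.comul c = ∑ j, y j ⊗ₜ[R] y' j →
    A.comul (A.mul b c) = ∑ i, ∑ j, A.mul (x i) (y j) ⊗ₜ[R] A.mul (x' i) (y' j)
  counit_one : A.counit (A.incl 1) = 1
  counit_mul : ∀ b c, A.counit (A.mul b c) = A.counit (A.mul b (A.incl (A.counit c)))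

/-- The tensor product `B ⊗_r B` for the two-sided `R`-module structure of `B`: the quotient of
`B ⊗_k B` by the relations `br ⊗ c = b ⊗ rc`. Its `R`-module structure is the left one,
`r(b ⊗ c) = rb ⊗ c`. -/
abbrev RkData.BiTensor (A : RkData k R B) : Type w :=
  (B ⊗[k] B) ⧸ Submodule.span R
    {z : B ⊗[k] B | ∃ (b c : B) (r : R),
      z = A.mul b (A.incl r) ⊗ₜ[k] c - b ⊗ₜ[k] A.mul (A.incl r) c}

/-- The projection `B ⊗_k B → B ⊗_r B`. -/
def RkData.biMk (A : RkData k R B) : B ⊗[k] B →ₗ[R] A.BiTensor :=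
  Submodule.mkQ _

/-- Right multiplication by `c` on the second factor of `B ⊗_k B`. -/
def RkData.mulRight (A : RkData k R B) (c : B) : B ⊗[k] B →ₗ[k] B ⊗[k] B :=
  (A.mul.flip c).lTensor B

/-- Antiproducts. All the conditions are expressed through arbitrary representatives of the elements
of `B ⊗_R B` and `B ⊗_r B` that occur. The `R`-linearity of `E` contains the law
`E(rb) = r E(b)`. The third condition compares two elements of `B ⊗_R (B ⊗_r B)`. -/
structure IsAntiproduct (A : RkData k R B) (E : B →ₗ[R] A.BiTensor) : Prop where
  /-- `E(rb) = E(b) r` -/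
  map_smul_right : ∀ (r : R) (b : B) (z : B ⊗[k] B), E b = A.biMk z →
    E (r • b) = A.biMk (A.mulRight (A.incl r) z)
  /-- `∑ E(b₁) b₂ = b ⊗ 1` -/
  sum_mul : ∀ (b : B) (n : ℕ) (x y : Fin n → B) (z : Fin n → B ⊗[k] B),
    A.comul b = ∑ i, x i ⊗ₜ[R] y i → (∀ i, E (x i) = A.biMk (z i)) →
    ∑ i, A.biMk (A.mulRight (y i) (z i)) = A.biMk (b ⊗ₜ[k] A.incl 1)
  /-- `(I ⊗ E)(Δ(b)) = (Δ ⊗ I)(E(b))` -/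
  lTensor_comul : ∀ (b : B) (n : ℕ) (x y : Fin n → B),
    E b = ∑ i, A.biMk (x i ⊗ₜ[k] y i) →
    E.lTensor B (A.comul b) =
      ∑ i, (A.biMk ∘ₗ (TensorProduct.AlgebraTensorModule.mk k R B B).flip (y i)).lTensor B
        (A.comul (x i))
  /-- `μ(E(b)) = ε(b) 1` -/
  mul_eq : ∀ (b : B) (z : B ⊗[k] B), E b = A.biMk z →
    TensorProduct.lift A.mul z = A.incl (A.counit b)

/-- `R/k`-Hopf algebras: `R/k`-bialgebras that have an antiproduct. -/
structure IsRkHopfAlgebra (A : RkData k R B) : Prop extends IsRkBialgebra A where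
  exists_antiproduct : ∃ E : B →ₗ[R] A.BiTensor, IsAntiproduct A E

/-- Homomorphisms of `R/k`-bialgebras: algebra homomorphisms that are the identity on `R` and
respect coproducts and counits. -/
structure IsRkBialgebraHom {B' : Type*} [AddCommGroup B'] [Module k B'] [Module R B']
    [IsScalarTower k R B'] (A : RkData k R B) (A' : RkData k R B') (f : B →ₗ[R] B') : Prop where
  map_mul : ∀ b c, f (A.mul b c) = A'.mul (f b) (f c)
  map_incl : ∀ r, f (A.incl r) = A'.incl r
  map_comul : ∀ b, A'.comul (f b) = TensorProduct.map f f (A.comul b)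
  map_counit : ∀ b, A'.counit (f b) = A.counit b

end Rk

/-! ## Module algebras and smash products -/

/-- The operations of a `k`-bialgebra on a vector space `H`, without any laws. -/
structure BialgData (k : Type u) (H : Type w) [Field k] [AddCommGroup H] [Module k H] where
  mul : H →ₗ[k] H →ₗ[k] H
  one : H
  comul : H →ₗ[k] H ⊗[k] H
  counit : H →ₗ[k] k

section Smash

variable {k : Type u} {R : Type v} {H : Type w} [Field k] [CommRing R] [Algebra k R]
  [AddCommGroup H] [Module k H]

/-- Homomorphisms of bialgebras. -/
structure IsBialgHom {H' : Type*} [AddCommGroup H'] [Module k H']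
    (A : BialgData k H) (A' : BialgData k H') (f : H →ₗ[k] H') : Prop where
  map_mul : ∀ h g, f (A.mul h g) = A'.mul (f h) (f g)
  map_one : f A.one = A'.one
  map_comul : ∀ h, A'.comul (f h) = TensorProduct.map f f (A.comul h)
  map_counit : ∀ h, A'.counit (f h) = A.counit h

/-- The linear map `act` makes the algebra `R` a left `H`-module algebra:
`h·(rs) = ∑ (h₁·r)(h₂·s)` and `h·1 = ε(h)1`. -/
structure IsModuleAlgebra (A : BialgData k H) (act : H →ₗ[k] Module.End k R) : Prop where
  one_act : act A.one = 1
  mul_act : ∀ h g, act (A.mul h g) = act h * act g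
  act_mul : ∀ (h : H) (r s : R), act h (r * s) =
    LinearMap.mul' k R (TensorProduct.map₂ act act (A.comul h) (r ⊗ₜ[k] s))
  act_one : ∀ h, act h 1 = algebraMap k R (A.counit h)

/-- The multiplication `(r # h)(s # g) = ∑ r (h₁·s) # h₂ g` of the smash product. -/
def smashMul (A : BialgData k H) (act : H →ₗ[k] Module.End k R) :
    R ⊗[k] H →ₗ[k] R ⊗[k] H →ₗ[k] R ⊗[k] H :=
  TensorProduct.lift (LinearMap.mk₂ k
    (fun (r : R) (h : H) => r • TensorProduct.map₂ act A.mul (A.comul h))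
    (fun _ _ _ => add_smul _ _ _) (fun _ _ _ => smul_assoc _ _ _)
    (fun _ _ _ => by simp only [map_add, smul_add])
    (fun c r h => by simp only [map_smul]; rw [smul_comm]))

/-- The smash product `R # H` on `R ⊗_k H`, with the `R`-coalgebra structure obtained from that of
`H` by extension of scalars. -/
def smash (A : BialgData k H) (act : H →ₗ[k] Module.End k R) : RkData k R (R ⊗[k] H) where
  mul := smashMul A act
  incl := (TensorProduct.mk k R H).flip A.one
  comul := (TensorProduct.AlgebraTensorModule.distribBaseChange k R H H).toLinearMap ∘ₗ
    A.comul.baseChange R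
  counit := (TensorProduct.AlgebraTensorModule.rid k R R).toLinearMap ∘ₗ A.counit.baseChange R

/-- The map `R # H → End_k(R)`, `r # h ↦ (s ↦ r (h·s))`. -/
def smashToEnd (act : H →ₗ[k] Module.End k R) : R ⊗[k] H →ₗ[k] Module.End k R :=
  TensorProduct.lift (LinearMap.mk₂ k (fun (r : R) (h : H) => r • act h)
    (fun _ _ _ => add_smul _ _ _) (fun _ _ _ => smul_assoc _ _ _)
    (fun _ _ _ => by simp only [map_add, smul_add])
    (fun c r h => by simp only [map_smul]; rw [smul_comm]))

end Smash

/-! ## The algebra of higher order derivations -/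

section Diff

attribute [local instance 100] LieRing.ofAssociativeRing

variable (k : Type u) (R : Type v) [Field k] [CommRing R] [Algebra k R]

/-- The Lie algebra of `k`-derivations of `R`. -/
abbrev Der : Type v := Derivation k R R

/-- The universal enveloping algebra of the Lie algebra of derivations of `R`. -/
abbrev UDer : Type (max u v) := UniversalEnvelopingAlgebra k (Der k R)

variable {k R}

/-- The canonical map `Der(R) → U(Der(R))`. -/
def iota : Der k R →ₗ[k] UDer k R := (UniversalEnvelopingAlgebra.ι k : Der k R →ₗ⁅k⁆ UDer k R)

variable (k R)

/-- The coproduct of `U(Der(R))`, for which derivations are primitive. -/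
def uComul : UDer k R →ₐ[k] UDer k R ⊗[k] UDer k R :=
  UniversalEnvelopingAlgebra.lift k
    { toFun := fun E => iota E ⊗ₜ[k] 1 + 1 ⊗ₜ[k] iota E
      map_add' := fun E F => by
        simp only [map_add, TensorProduct.add_tmul, TensorProduct.tmul_add]; abel
      map_smul' := fun c E => by
        simp only [map_smul, TensorProduct.smul_tmul', TensorProduct.tmul_smul, smul_add,
          RingHom.id_apply]
      map_lie' := fun {E F} => by
        have h : iota (k := k) ⁅E, F⁆ = iota E * iota F - iota F * iota E :=
          (UniversalEnvelopingAlgebra.ι k : Der k R →ₗ⁅k⁆ UDer k R).map_lie E F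
        simp only [h, LieRing.of_associative_ring_bracket, mul_add, add_mul,
          Algebra.TensorProduct.tmul_mul_tmul, one_mul, mul_one, TensorProduct.sub_tmul,
          TensorProduct.tmul_sub]
        abel }

theorem uComul_iota (E : Der k R) :
    uComul k R (iota E) = iota E ⊗ₜ[k] 1 + 1 ⊗ₜ[k] iota E :=
  UniversalEnvelopingAlgebra.lift_ι_apply k _ E

/-- The counit of `U(Der(R))`. -/
def uCounit : UDer k R →ₐ[k] k :=
  UniversalEnvelopingAlgebra.lift k (0 : Der k R →ₗ⁅k⁆ k)

/-- The natural action of `U(Der(R))` on `R`: a derivation `E` acts as `E`. -/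
def uAct : UDer k R →ₐ[k] Module.End k R :=
  UniversalEnvelopingAlgebra.lift k (LieModule.toEnd k (Der k R) R)

theorem uAct_iota (E : Der k R) (r : R) : uAct k R (iota E) r = E r := by
  have h : uAct k R (iota E) = LieModule.toEnd k (Der k R) R E :=
    UniversalEnvelopingAlgebra.lift_ι_apply k _ E
  rw [h]; rfl

variable {k R}

/-- `Diff_k(S)`: the subalgebra of `U(Der(R))` generated by a set `S` of derivations. -/
def Diff (S : Set (Der k R)) : Subalgebra k (UDer k R) :=
  Algebra.adjoin k (iota '' S)

theorem iota_mem_Diff {S : Set (Der k R)} {E : Der k R} (hE : E ∈ S) : iota E ∈ Diff S :=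
  Algebra.subset_adjoin ⟨E, hE, rfl⟩

/-- The inclusion `Diff_k(S) ⊗ Diff_k(S) → U(Der(R)) ⊗ U(Der(R))`. -/
def diffInclTensor (S : Set (Der k R)) : Diff S ⊗[k] Diff S →ₐ[k] UDer k R ⊗[k] UDer k R :=
  Algebra.TensorProduct.map (Diff S).val (Diff S).val

theorem diffInclTensor_injective (S : Set (Der k R)) :
    Function.Injective (diffInclTensor S) :=
  TensorProduct.map_injective_of_flat_flat (Diff S).val.toLinearMap (Diff S).val.toLinearMap
    Subtype.val_injective Subtype.val_injective

theorem uComul_mem (S : Set (Der k R)) (x : Diff S) :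
    uComul k R x ∈ (diffInclTensor S).range := by
  have h : Diff S ≤ (diffInclTensor S).range.comap (uComul k R) := by
    refine Algebra.adjoin_le ?_
    rintro _ ⟨E, hE, rfl⟩
    refine ⟨⟨iota E, iota_mem_Diff hE⟩ ⊗ₜ[k] 1 + 1 ⊗ₜ[k] ⟨iota E, iota_mem_Diff hE⟩, ?_⟩
    simp [diffInclTensor, uComul_iota]
  exact h x.2

/-- The coproduct of `Diff_k(S)`: the restriction of the coproduct of `U(Der(R))`. -/
def diffComul (S : Set (Der k R)) : Diff S →ₐ[k] Diff S ⊗[k] Diff S :=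
  (AlgEquiv.ofInjective (diffInclTensor S) (diffInclTensor_injective S)).symm.toAlgHom.comp
    (((uComul k R).comp (Diff S).val).codRestrict (diffInclTensor S).range (uComul_mem S))

theorem diffInclTensor_diffComul (S : Set (Der k R)) (x : Diff S) :
    diffInclTensor S (diffComul S x) = uComul k R x :=
  congrArg Subtype.val
    ((AlgEquiv.ofInjective (diffInclTensor S) (diffInclTensor_injective S)).apply_symm_apply
      ⟨uComul k R x, uComul_mem S x⟩)

/-- The bialgebra `Diff_k(S)`. -/
def diffData (S : Set (Der k R)) : BialgData k (Diff S) where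
  mul := LinearMap.mul k (Diff S)
  one := 1
  comul := (diffComul S).toLinearMap
  counit := ((uCounit k R).comp (Diff S).val).toLinearMap

/-- The natural action of `Diff_k(S)` on `R`. -/
def diffAct (S : Set (Der k R)) : Diff S →ₗ[k] Module.End k R :=
  ((uAct k R).comp (Diff S).val).toLinearMap

end Diff

/-! ## The bialgebra of labeled ordered trees -/

/-- Ordered rooted trees in which every node other than the root carries a label in `α`.
`one` is the tree that consists of a root only. In `cons a C T` the first child of the root
is labeled `a`; the subtree below this child, with the child as its (then unlabeled) root, is `C`;
and removing the first child with everything below it leaves `T`. -/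
inductive OTree (α : Type*) : Type _
  | one : OTree α
  | cons (a : α) (C T : OTree α) : OTree α

namespace OTree

variable {α : Type*}

/-- The tree `v(a)` with two nodes, the root and a child labeled `a`. -/
def v (a : α) : OTree α := cons a one one

/-- The tree `t(T₁, T₂)`: the roots are identified, the children of the root of `T₁` come
first. -/
def join : OTree α → OTree α → OTree α
  | one, T => T
  | cons a C T', T => cons a C (join T' T)

/-- The pairs `(T_X, T_Y)`, where `X` runs over the subsets of the set of children of the root of `T`
(with everything below them), `Y` is the complement of `X`, and the order is preserved. -/
def splits : OTree α → List (OTree α × OTree α)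
  | one => [(one, one)]
  | cons a C T => (splits T).flatMap fun p => [(cons a C p.1, p.2), (p.1, cons a C p.2)]

/-- `inner T₂ T₁` lists the trees obtained by linking each child of the root of `T₁` to some node
of `T₂` other than the root. At every node the new children precede the old ones and keep
their order. -/
def inner : OTree α → OTree α → List (OTree α)
  | one, one => [one]
  | one, cons _ _ _ => []
  | cons a C T, F =>
      -- `p.1` goes to the first child of the root or below, `p.2` goes to the nodes of `T`;
      -- `q.1` goes to the first child itself, `q.2` goes below it
      (splits F).flatMap fun p => (splits p.1).flatMap fun q =>
        (inner C q.2).flatMap fun C' => (inner T p.2).map fun T' => cons a (join q.1 C') T'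

/-- `graftings T₁ T₂` lists the trees `T_d`, where `d` runs over the functions from the set of children
of the root of `T₁` to the set of nodes of `T₂`, and `T_d` is obtained by linking each child
`c` to the node `d c`. -/
def graftings (T₁ T₂ : OTree α) : List (OTree α) :=
  (splits T₁).flatMap fun p => (inner T₂ p.2).map fun T => join p.1 T

end OTree

section Trees

variable (k : Type u) [Field k] (α : Type v)

/-- The vector space `k{LT(α)}` with basis the labeled ordered trees. -/
abbrev KLT : Type (max u v) := OTree α →₀ k

/-- The bialgebra structure of `k{LT(α)}`:
`T₁ · T₂ = ∑_d T_d`, `Δ(T) = ∑_X T_X ⊗ T_Y`, and `ε(T) = 1` if `T` is the one-node tree and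
`ε(T) = 0` otherwise. -/
def treeData : BialgData k (KLT k α) where
  mul := Finsupp.linearCombination k fun T₁ : OTree α =>
    Finsupp.linearCombination k fun T₂ : OTree α =>
      ((OTree.graftings T₁ T₂).map fun T => (Finsupp.single T 1 : KLT k α)).sum
  one := Finsupp.single OTree.one 1
  comul := Finsupp.linearCombination k fun T : OTree α =>
    ((OTree.splits T).map fun p =>
      (Finsupp.single p.1 1 : KLT k α) ⊗ₜ[k] (Finsupp.single p.2 1 : KLT k α)).sum
  counit := Finsupp.lapply OTree.one

end Trees

/-! ## Connections and the action of trees by differential operators -/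

/-- Connections on `Der(R)`. -/
structure Connection (k : Type u) (R : Type v) [Field k] [CommRing R] [Algebra k R] where
  /-- `nabla E F` is the covariant derivative of `F` in the direction of `E`. -/
  nabla : Der k R → Der k R → Der k R
  add_left : ∀ E₁ E₂ F, nabla (E₁ + E₂) F = nabla E₁ F + nabla E₂ F
  add_right : ∀ E F₁ F₂, nabla E (F₁ + F₂) = nabla E F₁ + nabla E F₂
  smul_left : ∀ (f : R) E F, nabla (f • E) F = f • nabla E F
  leibniz : ∀ (f : R) E F, nabla E (f • F) = f • nabla E F + E f • F

namespace Connection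

variable {k : Type u} {R : Type v} [Field k] [CommRing R] [Algebra k R] (N : Connection k R)

/-- The derivation as which the tree `u(E; v(F₁), …, v(Fₙ))` acts. This is the iterated covariant
derivative: it is `E` for `n = 0`, and for `n + 1` it is
`∇_{F₁} D(F₂, …, Fₙ₊₁) - ∑_ℓ D(F₂, …, ∇_{F₁} F_ℓ, …, Fₙ₊₁)`. -/
def covDer (E : Der k R) : (n : ℕ) → (Fin n → Der k R) → Der k R
  | 0, _ => E
  | n + 1, F => N.nabla (F 0) (covDer E n (Fin.tail F)) -
      ∑ l : Fin n, covDer E n (Function.update (Fin.tail F) l (N.nabla (F 0) (Fin.tail F l)))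

/-- The element of `U(Der(R))` as which the tree `t(v(F₁), …, v(Fₙ))` acts: it is `1` for `n = 0`,
and for `n + 1` it is `F₁ · D(F₂, …, Fₙ₊₁) - ∑_ℓ D(F₂, …, ∇_{F₁} F_ℓ, …, Fₙ₊₁)`. -/
def covOp : (n : ℕ) → (Fin n → Der k R) → UDer k R
  | 0, _ => 1
  | n + 1, F => iota (F 0) * covOp n (Fin.tail F) -
      ∑ l : Fin n, covOp n (Function.update (Fin.tail F) l (N.nabla (F 0) (Fin.tail F l)))

/-- The list of the derivations as which the subtrees `u(E; C)` of a tree act, one for each child of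
the root; `E` is the label of the child and `C` is the tree below it. -/
def branchDers {α : Type*} (label : α → Der k R) : OTree α → List (Der k R)
  | .one => []
  | .cons a C T =>
      N.covDer (label a) (branchDers label C).length (branchDers label C).get ::
        branchDers label T

/-- The element of `U(Der(R))` as which a labeled tree acts. -/
def treeOp {α : Type*} (label : α → Der k R) (T : OTree α) : UDer k R :=
  N.covOp (N.branchDers label T).length (N.branchDers label T).get

/-- The map `k{LT(S)} → U(Der(R))` that the connection defines. -/
def treeMap (S : Set (Der k R)) : KLT k S →ₗ[k] UDer k R :=
  Finsupp.linearCombination k fun T : OTree S => N.treeOp Subtype.val T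

/-- The action of `k{LT(S)}` on `R` that the connection defines. -/
def treeAct (S : Set (Der k R)) : KLT k S →ₗ[k] Module.End k R :=
  (uAct k R).toLinearMap ∘ₗ N.treeMap S

/-- The map `k{LT(S)} → U(Der(R))` defined by the connection, as a map to a subalgebra `Diff_k(S')`
that contains its image. -/
def treeMapTo (S S' : Set (Der k R)) (h : ∀ x, N.treeMap S x ∈ Diff S') : KLT k S →ₗ[k] Diff S' where
  toFun x := ⟨N.treeMap S x, h x⟩
  map_add' x y := Subtype.ext (map_add (N.treeMap S) x y)
  map_smul' c x := Subtype.ext (map_smul (N.treeMap S) c x)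

end Connection

end TreeHopf

end

/-! Both `Diff S` and the algebra of trees are Hopf algebras generated by primitive elements, and
this single property carries the whole theorem. A primitive `x` acts on `R` as a derivation, so in
the smash product it satisfies `(1 # x) r = r (1 # x) + x·r`. Every law of an `R/k`-Hopf algebra is
checked for such `x` and extended to products `x₁ ⋯ xₙ` by induction. The result is
`Smash.isRkHopfAlgebra`, with antiproduct `E(r # h) = ∑ (r # h₁) ⊗ (1 # S(h₂))`. The delicate law is
`E(rb) = E(b) r`. It holds because `E(1 # xh)` is the commutator of `1 # x` with `E(1 # h)`, and the
two terms containing `x·r` cancel.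

For trees, let `B ▷ T` be the sum of the trees obtained by linking the children of the root of `B`
to nodes of `T` other than the root. Associativity comes down to the identity that linking `G` into
`T` in this way, and then `F` into the result, is the same as linking the product `F · G`
(`sumInner_sumInner`). If the root of `B` has one child, call `B` planted. Then `B` is primitive and
`B · T = t(B, T) + B ▷ T`, where the trees in `B ▷ T` have as many children at the root as `T`.
Induction on that number shows that planted trees generate. The antipode is a geometric series in
the convolution algebra, finite on each tree.

Consequently a linear map out of the trees is a bialgebra homomorphism as soon as it preserves the
unit, preserves products `B · T` with `B` planted, and maps planted trees to primitive elements
(`isBialgHom_of_planted`). The map that multiplies the labels of the children of the root and kills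
all deeper trees has these properties, because it vanishes on `B ▷ T` (`leafProd`).

For a connection, let `X` be the derivation of `B` and `F₁, …, Fₙ` the derivations of the branches
of `T`. The recursion for `P` reads `X Pₙ(F₁, …, Fₙ) = Pₙ₊₁(X, F₁, …, Fₙ) + ∑ Pₙ(…, ∇_X F_l, …)`.
The first term belongs to `t(B, T)`. The second belongs to `B ▷ T`, since linking `B` in all
possible ways to the non-root nodes of one branch replaces the derivation of that branch by its
covariant derivative along `X` (`sumInner_planted_branchDers`). That in turn is the recursion
defining `∇ⁿ`, read from right to left. -/

noncomputable section

namespace TreeHopf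

universe u v w

/-! ## Sums over decompositions and graftings of trees -/

namespace OTree

variable {α : Type*} {M N : Type*} [AddCommMonoid M] [AddCommMonoid N]

/-- The sum of the values of `f` over a list. -/
def listSum {β : Type*} (l : List β) (f : β → M) : M := (l.map f).sum

theorem listSum_add {β : Type*} (l : List β) (f g : β → M) :
    listSum l (fun x => f x + g x) = listSum l f + listSum l g := by
  induction l with
  | nil => simp [listSum]
  | cons a l ih => simp only [listSum, List.map_cons, List.sum_cons] at ih ⊢; rw [ih]; abel

theorem listSum_zero {β : Type*} (l : List β) : listSum l (fun _ => (0 : M)) = 0 := by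
  induction l with
  | nil => simp [listSum]
  | cons a l ih => simp only [listSum, List.map_cons, List.sum_cons] at ih ⊢; rw [ih, add_zero]

theorem map_listSum {β : Type*} {F : Type*} [FunLike F M N] [AddMonoidHomClass F M N] (g : F)
    (l : List β) (f : β → M) : g (listSum l f) = listSum l fun x => g (f x) := by
  induction l with
  | nil => simp [listSum]
  | cons a l ih => simp only [listSum, List.map_cons, List.sum_cons] at ih ⊢; rw [map_add, ih]

theorem listSum_comm {β γ : Type*} (l : List β) (l' : List γ) (f : β → γ → M) :
    listSum l (fun x => listSum l' (f x)) = listSum l' fun y => listSum l fun x => f x y := by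
  induction l with
  | nil => exact (listSum_zero l').symm
  | cons a l ih =>
    calc listSum (a :: l) (fun x => listSum l' (f x))
        = listSum l' (f a) + listSum l (fun x => listSum l' (f x)) := by simp [listSum]
      _ = listSum l' fun y => f a y + listSum l fun x => f x y := by rw [ih, listSum_add]
      _ = _ := by simp [listSum]

theorem listSum_flatMap {β γ : Type*} (l : List β) (g : β → List γ) (f : γ → M) :
    listSum (l.flatMap g) f = listSum l fun x => listSum (g x) f := by
  induction l with
  | nil => simp [listSum]
  | cons a l ih =>
    simp only [listSum, List.flatMap_cons, List.map_append, List.sum_append, List.map_cons,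
      List.sum_cons] at ih ⊢
    rw [ih]

theorem listSum_map {β γ : Type*} (l : List β) (g : β → γ) (f : γ → M) :
    listSum (l.map g) f = listSum l fun x => f (g x) := by
  simp [listSum, Function.comp_def]

/-- The sum of `f T_X T_Y` over the decompositions of the set of children of the root of `T`. -/
def sumSplits (T : OTree α) (f : OTree α → OTree α → M) : M :=
  listSum (splits T) fun p => f p.1 p.2

/-- The sum of `f` over the trees obtained by linking the children of the root of `F` to nodes of
`T` other than the root. -/
def sumInner (T F : OTree α) (f : OTree α → M) : M := listSum (inner T F) f

/-- The sum of `f` over the trees obtained by linking the children of the root of `F` to nodes of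
`T`. -/
def sumGraft (F T : OTree α) (f : OTree α → M) : M := listSum (graftings F T) f

theorem join_one (T : OTree α) : join T one = T := by
  induction T with
  | one => rfl
  | cons a C T _ ih => rw [join, ih]

theorem join_assoc (A B C : OTree α) : join (join A B) C = join A (join B C) := by
  induction A with
  | one => rfl
  | cons a C' T _ ih => simp only [join, ih]

theorem sumSplits_add (T : OTree α) (f g : OTree α → OTree α → M) :
    sumSplits T (fun x y => f x y + g x y) = sumSplits T f + sumSplits T g :=
  listSum_add _ _ _

theorem sumSplits_zero (T : OTree α) : sumSplits T (fun _ _ => (0 : M)) = 0 := listSum_zero _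

theorem sumInner_add (T F : OTree α) (f g : OTree α → M) :
    sumInner T F (fun x => f x + g x) = sumInner T F f + sumInner T F g :=
  listSum_add _ _ _

theorem sumInner_zero (T F : OTree α) : sumInner T F (fun _ => (0 : M)) = 0 := listSum_zero _

theorem sumGraft_add (T F : OTree α) (f g : OTree α → M) :
    sumGraft T F (fun x => f x + g x) = sumGraft T F f + sumGraft T F g :=
  listSum_add _ _ _

theorem sumSplits_comm (T U : OTree α) (f : OTree α → OTree α → OTree α → OTree α → M) :
    sumSplits T (fun x y => sumSplits U (f x y)) =
      sumSplits U fun z w => sumSplits T fun x y => f x y z w :=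
  listSum_comm _ _ _

theorem sumInner_sumSplits_comm (T F U : OTree α) (f : OTree α → OTree α → OTree α → M) :
    sumInner T F (fun x => sumSplits U (f x)) =
      sumSplits U fun z w => sumInner T F fun x => f x z w :=
  listSum_comm _ _ _

theorem sumGraft_sumSplits_comm (F T U : OTree α) (f : OTree α → OTree α → OTree α → M) :
    sumGraft F T (fun x => sumSplits U (f x)) =
      sumSplits U fun z w => sumGraft F T fun x => f x z w :=
  listSum_comm _ _ _

theorem sumInner_comm (T F U G : OTree α) (f : OTree α → OTree α → M) :
    sumInner T F (fun x => sumInner U G (f x)) =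
      sumInner U G fun z => sumInner T F fun x => f x z :=
  listSum_comm _ _ _

theorem sumGraft_comm (F T G U : OTree α) (f : OTree α → OTree α → M) :
    sumGraft F T (fun x => sumGraft G U (f x)) =
      sumGraft G U fun z => sumGraft F T fun x => f x z :=
  listSum_comm _ _ _

theorem sumInner_sumGraft_comm (T F U G : OTree α) (f : OTree α → OTree α → M) :
    sumInner T F (fun x => sumGraft G U (f x)) =
      sumGraft G U fun z => sumInner T F fun x => f x z :=
  listSum_comm _ _ _

theorem sumSplits_one (f : OTree α → OTree α → M) : sumSplits one f = f one one := by
  simp [sumSplits, splits, listSum]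

theorem sumSplits_cons (a : α) (C T : OTree α) (f : OTree α → OTree α → M) :
    sumSplits (cons a C T) f = sumSplits T fun x y => f (cons a C x) y + f x (cons a C y) := by
  simp only [sumSplits, splits, listSum_flatMap]
  simp [listSum]

theorem sumGraft_eq (F T : OTree α) (f : OTree α → M) :
    sumGraft F T f = sumSplits F fun A B => sumInner T B fun T' => f (join A T') := by
  simp only [sumGraft, graftings, listSum_flatMap, listSum_map]; rfl

theorem sumInner_one_one (f : OTree α → M) : sumInner one one f = f one := by
  simp [sumInner, inner, listSum]

theorem sumInner_one_cons (a : α) (C T : OTree α) (f : OTree α → M) :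
    sumInner one (cons a C T) f = 0 := by
  simp [sumInner, inner, listSum]

/-- The node `a` is the root of `C` and is an admissible target, so the children sent into the first
branch form a full grafting onto `C`. The root of `T` is still the forbidden one. -/
theorem sumInner_cons (a : α) (C T F : OTree α) (f : OTree α → M) :
    sumInner (cons a C T) F f = sumSplits F fun F₁ F₂ => sumGraft F₁ C fun C' =>
      sumInner T F₂ fun T' => f (cons a C' T') := by
  simp only [sumInner, inner, listSum_flatMap, listSum_map, sumGraft_eq]; rfl

/-- The underlying lists agree only up to order, so the identities are stated for sums of an
arbitrary `f`. This generality also feeds the inductions, in which `f` changes from a tree to its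
subtrees. -/
theorem sumSplits_coassoc (T : OTree α) (f : OTree α → OTree α → OTree α → M) :
    sumSplits T (fun x y => sumSplits x fun z w => f z w y) =
      sumSplits T fun x y => sumSplits y fun z w => f x z w := by
  induction T generalizing f with
  | one => simp only [sumSplits_one]
  | cons a C T _ ih =>
    simp only [sumSplits_cons]
    rw [sumSplits_add, ih, ih, ← sumSplits_add]
    simp only [← sumSplits_add, add_assoc]

theorem sumSplits_swap (T : OTree α) (f : OTree α → OTree α → M) :
    sumSplits T f = sumSplits T fun x y => f y x := by
  induction T generalizing f with
  | one => simp only [sumSplits_one]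
  | cons a C T _ ih =>
    simp only [sumSplits_cons]
    rw [ih]
    simp only [add_comm]

theorem sumSplits_left_comm (T : OTree α) (f : OTree α → OTree α → OTree α → M) :
    sumSplits T (fun x y => sumSplits y fun z w => f x z w) =
      sumSplits T fun x y => sumSplits y fun z w => f z x w := by
  rw [← sumSplits_coassoc, ← sumSplits_coassoc]
  congr 1; funext x y
  exact sumSplits_swap _ _

/-- Exchange of the two middle factors of the fourfold coproduct, a consequence of coassociativity
and cocommutativity. -/
theorem sumSplits_interchange (T : OTree α)
    (f : OTree α → OTree α → OTree α → OTree α → M) :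
    sumSplits T (fun x y => sumSplits x fun z w => sumSplits y fun z' w' => f z w z' w') =
      sumSplits T fun x y => sumSplits x fun z w => sumSplits y fun z' w' => f z z' w w' := by
  rw [sumSplits_coassoc T fun z w y => sumSplits y fun z' w' => f z w z' w',
    sumSplits_coassoc T fun z w y => sumSplits y fun z' w' => f z z' w w']
  congr 1; funext x y
  exact sumSplits_left_comm y fun w z' w' => f x w z' w'

theorem sumSplits_of_left (T : OTree α) (f : OTree α → OTree α → M)
    (hf : ∀ a C T U, f (cons a C T) U = 0) : sumSplits T f = f one T := by
  induction T generalizing f with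
  | one => rw [sumSplits_one]
  | cons a C T _ ih =>
    rw [sumSplits_cons]
    simp only [hf, zero_add]
    exact ih _ fun _ _ _ _ => hf _ _ _ _

theorem sumSplits_of_right (T : OTree α) (f : OTree α → OTree α → M)
    (hf : ∀ a C T U, f U (cons a C T) = 0) : sumSplits T f = f T one := by
  rw [sumSplits_swap]
  exact sumSplits_of_left T _ hf

theorem sumSplits_join (A B : OTree α) (f : OTree α → OTree α → M) :
    sumSplits (join A B) f = sumSplits A fun a₁ a₂ => sumSplits B fun b₁ b₂ =>
      f (join a₁ b₁) (join a₂ b₂) := by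
  induction A generalizing f with
  | one => rw [sumSplits_one]; rfl
  | cons a C T _ ih =>
    simp only [join, sumSplits_cons, ih, sumSplits_add]

theorem sumInner_right_one (T : OTree α) (f : OTree α → M) : sumInner T one f = f T := by
  induction T generalizing f with
  | one => rw [sumInner_one_one]
  | cons a C T hC hT =>
    simp only [sumInner_cons, sumGraft_eq, sumSplits_one, hC, hT]; rfl

theorem sumGraft_one_left (T : OTree α) (f : OTree α → M) : sumGraft one T f = f T := by
  simp only [sumGraft_eq, sumSplits_one, sumInner_right_one]; rfl

theorem sumGraft_one_right (F : OTree α) (f : OTree α → M) : sumGraft F one f = f F := by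
  rw [sumGraft_eq, sumSplits_of_right _ _ fun _ _ _ _ => sumInner_one_cons _ _ _ _,
    sumInner_one_one, join_one]

theorem sumInner_one_left_join_cons (A : OTree α) (a : α) (C T : OTree α) (f : OTree α → M) :
    sumInner one (join A (cons a C T)) f = 0 := by
  cases A <;> exact sumInner_one_cons _ _ _ _

theorem sumInner_join (A B F : OTree α) (f : OTree α → M) :
    sumInner (join A B) F f = sumSplits F fun F₁ F₂ => sumInner A F₁ fun A' =>
      sumInner B F₂ fun B' => f (join A' B') := by
  induction A generalizing F f with
  | one =>
    rw [sumSplits_of_left _ _ fun _ _ _ _ => sumInner_one_cons _ _ _ _, sumInner_one_one]; rfl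
  | cons a C T _ ih =>
    simp only [join, sumInner_cons, ih]
    rw [sumSplits_coassoc F fun x y z => sumGraft x C fun C' => sumInner T y fun T' =>
      sumInner B z fun B' => f (cons a C' (join T' B'))]
    simp only [sumGraft_sumSplits_comm]

/-- A linked child of the root of `F` follows the branch of `T` that receives it. Hence choosing a
subset of the branches after the linking is the same as distributing both the branches of `T` and
the children from `F` over the two sides beforehand. -/
theorem sumInner_sumSplits (T F : OTree α) (f : OTree α → OTree α → M) :
    sumInner T F (fun T' => sumSplits T' f) = sumSplits F fun F₁ F₂ => sumSplits T fun T₁ T₂ =>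
      sumInner T₁ F₁ fun A => sumInner T₂ F₂ fun B => f A B := by
  induction T generalizing F f with
  | one =>
    simp only [sumSplits_one]
    rw [sumSplits_of_left _ _ fun _ _ _ _ => sumInner_one_cons _ _ _ _, sumInner_one_one]
    cases F
    · simp only [sumInner_one_one, sumSplits_one]
    · simp only [sumInner_one_cons]
  | cons a C T _ ih =>
    simp only [sumSplits_cons, sumInner_cons, ih, sumGraft_sumSplits_comm]
    simp only [sumInner_add, sumGraft_add, sumSplits_add]
    congr 1
    · rw [← sumSplits_coassoc F]
      congr 1; funext x y
      rw [sumSplits_comm]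
    · rw [sumSplits_left_comm F]
      congr 1; funext x y
      simp only [sumInner_sumSplits_comm]
      rw [sumSplits_comm]
      congr 1; funext z w
      congr 1; funext z' w'
      simp only [sumInner_sumGraft_comm]

theorem sumGraft_sumSplits (F T : OTree α) (f : OTree α → OTree α → M) :
    sumGraft F T (fun T' => sumSplits T' f) = sumSplits F fun F₁ F₂ => sumSplits T fun T₁ T₂ =>
      sumGraft F₁ T₁ fun A => sumGraft F₂ T₂ fun B => f A B := by
  simp only [sumGraft_eq, sumSplits_join, sumInner_sumSplits_comm, sumInner_sumSplits]
  calc _ = sumSplits F fun x y => sumSplits x fun z w => sumSplits y fun z' w' =>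
        sumSplits T fun T₁ T₂ => sumInner T₁ z' fun A => sumInner T₂ w' fun B =>
          f (join z A) (join w B) := rfl
    _ = _ := by
      rw [sumSplits_interchange]
      congr 1; funext x y
      rw [sumSplits_comm T x]
      congr 1; funext z w
      exact sumSplits_comm y T _

/-- A child from `F` goes to the root of `C`, to a child from `G` that was linked to that root (or
below it), or to a node that was obtained off the root; only the last case needs `h`. The hypothesis
concerns one fixed `C`, so that the lemma can be applied to a subtree inside the next induction. -/
theorem sumGraft_assoc_of {C : OTree α}
    (h : ∀ (F G : OTree α) (f : OTree α → M), sumInner C G (fun C' => sumInner C' F f) =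
      sumGraft F G fun H => sumInner C H f) (F G : OTree α) (f : OTree α → M) :
    sumGraft G C (fun C' => sumGraft F C' f) = sumGraft F G fun H => sumGraft H C f := by
  calc _ = sumSplits F fun x y => sumSplits y fun y z => sumSplits G fun G₁ G₂ =>
        sumInner G₁ y fun A => sumInner C G₂ fun C' => sumInner C' z fun T =>
          f (join x (join A T)) := by
        simp only [sumGraft_eq, sumInner_join, sumInner_sumSplits_comm]
        rw [sumSplits_comm]
        congr 1; funext x y
        rw [sumSplits_comm]
        congr 1; funext z w
        congr 1; funext z' w'
        rw [sumInner_comm]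
    _ = _ := by
        simp only [sumGraft_eq _ C, sumGraft_sumSplits, ← h]
        simp only [sumGraft_eq, join_assoc]
        rw [← sumSplits_coassoc F]
        congr 1; funext x y
        rw [sumSplits_comm]

/-- Linking off the root is an action of the grafting product. In the first branch `C` the linking
may also use the root of `C`, so the required statement is associativity of grafting onto `C`. The
induction hypothesis for `C` gives it through `sumGraft_assoc_of`. -/
theorem sumInner_sumInner (T F G : OTree α) (f : OTree α → M) :
    sumInner T G (fun T' => sumInner T' F f) = sumGraft F G fun H => sumInner T H f := by
  induction T generalizing F G f with
  | one =>
    cases G with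
    | one => rw [sumInner_one_one, sumGraft_one_right]
    | cons a C T =>
      simp only [sumInner_one_cons, sumGraft_eq, sumInner_cons, sumInner_one_left_join_cons,
        sumInner_zero, sumSplits_zero]
  | cons a C T hC hT =>
    simp only [sumInner_cons, sumGraft_sumSplits, sumInner_sumSplits_comm,
      sumGraft_sumSplits_comm]
    rw [sumSplits_comm]
    congr 1; funext x y
    congr 1; funext z w
    simp only [sumInner_sumGraft_comm]
    rw [sumGraft_assoc_of fun F G f => hC F G f]
    simp only [hT]
    congr 1; funext A
    exact sumGraft_comm _ _ _ _ _

theorem sumGraft_assoc (F G T : OTree α) (f : OTree α → M) :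
    sumGraft G T (fun T' => sumGraft F T' f) = sumGraft F G fun H => sumGraft H T f :=
  sumGraft_assoc_of (fun F G f => sumInner_sumInner T F G f) F G f

end OTree

/-! ## The Hopf algebra of labeled ordered trees -/

/-- The operations of a bialgebra. -/
def BialgData.of (k : Type u) (H : Type w) [Field k] [Ring H] [Bialgebra k H] : BialgData k H where
  mul := LinearMap.mul k H
  one := 1
  comul := Coalgebra.comul
  counit := Coalgebra.counit

/-- The vector space `k{LT(α)}`, as the carrier of the Hopf algebra of labeled ordered trees. -/
def TreeAlgebra (k : Type u) [Field k] (α : Type v) : Type (max u v) := KLT k α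

namespace TreeAlgebra

open OTree Coalgebra

variable {k : Type u} [Field k] {α : Type v}

instance : AddCommGroup (TreeAlgebra k α) := inferInstanceAs (AddCommGroup (KLT k α))

instance : Module k (TreeAlgebra k α) := inferInstanceAs (Module k (KLT k α))

/-- The basis vector given by a tree. -/
def ofTree (T : OTree α) : TreeAlgebra k α := (Finsupp.single T 1 : KLT k α)

theorem induction {p : TreeAlgebra k α → Prop} (hadd : ∀ x y, p x → p y → p (x + y))
    (hsmul : ∀ (c : k) x, p x → p (c • x)) (htree : ∀ T, p (ofTree T)) (x : TreeAlgebra k α) :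
    p x := by
  refine Finsupp.induction_linear (motive := p) x ?_ hadd fun T c => ?_
  · have := hsmul 0 _ (htree one)
    rwa [zero_smul] at this
  · have := hsmul c _ (htree T)
    rwa [show c • (ofTree T : TreeAlgebra k α) = Finsupp.single T c from by
      refine (Finsupp.smul_single c T (1 : k)).trans ?_
      rw [smul_eq_mul, mul_one]] at this

theorem linearMap_ext {V : Type*} [AddCommGroup V] [Module k V] {f g : TreeAlgebra k α →ₗ[k] V}
    (h : ∀ T, f (ofTree T) = g (ofTree T)) : f = g := by
  ext x
  induction x using induction with
  | hadd x y hx hy => rw [map_add, map_add, hx, hy]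
  | hsmul c x hx => rw [map_smul, map_smul, hx]
  | htree T => exact h T

/-- The product of `k{LT(α)}`. -/
def mulHom : TreeAlgebra k α →ₗ[k] TreeAlgebra k α →ₗ[k] TreeAlgebra k α := (treeData k α).mul

theorem mulHom_ofTree (F T : OTree α) :
    mulHom (ofTree F : TreeAlgebra k α) (ofTree T) = sumGraft F T ofTree := by
  refine (congrArg (fun f : KLT k α →ₗ[k] KLT k α => f (Finsupp.single T 1))
    (Finsupp.linearCombination_single k (1 : k) F)).trans ?_
  rw [one_smul]
  refine (Finsupp.linearCombination_single k (1 : k) T).trans ?_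
  rw [one_smul]; rfl

theorem mulHom_sumGraft (F T : OTree α) (y : TreeAlgebra k α) :
    mulHom (sumGraft F T ofTree) y = sumGraft F T fun A => mulHom (ofTree A) y :=
  map_listSum (mulHom.flip y) _ _

theorem mulHom_assoc (x y z : TreeAlgebra k α) :
    mulHom (mulHom x y) z = mulHom x (mulHom y z) := by
  induction x using induction with
  | hadd x x' hx hx' => simp only [map_add, LinearMap.add_apply, hx, hx']
  | hsmul c x hx => simp only [map_smul, LinearMap.smul_apply, hx]
  | htree F =>
  induction y using induction with
  | hadd x x' hx hx' => simp only [map_add, LinearMap.add_apply, hx, hx']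
  | hsmul c x hx => simp only [map_smul, LinearMap.smul_apply, hx]
  | htree G =>
  induction z using induction with
  | hadd x x' hx hx' => simp only [map_add, hx, hx']
  | hsmul c x hx => simp only [map_smul, hx]
  | htree T =>
  rw [mulHom_ofTree, mulHom_ofTree, mulHom_sumGraft, sumGraft, sumGraft, map_listSum]
  simp only [mulHom_ofTree]
  exact (sumGraft_assoc F G T _).symm

theorem mulHom_one_left (x : TreeAlgebra k α) : mulHom (ofTree one) x = x := by
  induction x using induction with
  | hadd x x' hx hx' => rw [map_add, hx, hx']
  | hsmul c x hx => rw [map_smul, hx]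
  | htree T => exact (mulHom_ofTree _ _).trans (sumGraft_one_left _ _)

theorem mulHom_one_right (x : TreeAlgebra k α) : mulHom x (ofTree one) = x := by
  induction x using induction with
  | hadd x x' hx hx' => rw [map_add, LinearMap.add_apply, hx, hx']
  | hsmul c x hx => rw [map_smul, LinearMap.smul_apply, hx]
  | htree T => exact (mulHom_ofTree _ _).trans (sumGraft_one_right _ _)

instance : Ring (TreeAlgebra k α) where
  __ := (inferInstance : AddCommGroup (TreeAlgebra k α))
  mul x y := mulHom x y
  one := ofTree one
  left_distrib x y z := map_add (mulHom x) y z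
  right_distrib x y z := LinearMap.map_add₂ mulHom x y z
  zero_mul x := LinearMap.map_zero₂ mulHom x
  mul_zero x := map_zero (mulHom x)
  mul_assoc := mulHom_assoc
  one_mul := mulHom_one_left
  mul_one := mulHom_one_right

theorem one_def : (1 : TreeAlgebra k α) = ofTree one := rfl

theorem ofTree_mul (F T : OTree α) :
    (ofTree F * ofTree T : TreeAlgebra k α) = sumGraft F T ofTree := mulHom_ofTree F T

instance : Algebra k (TreeAlgebra k α) :=
  Algebra.ofModule (fun c x y => LinearMap.map_smul₂ mulHom c x y)
    fun c x y => map_smul (mulHom x) c y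

instance : CoalgebraStruct k (TreeAlgebra k α) where
  comul := (treeData k α).comul
  counit := (treeData k α).counit

theorem comul_ofTree (T : OTree α) :
    comul (R := k) (ofTree T : TreeAlgebra k α) =
      sumSplits T fun A B => ofTree A ⊗ₜ[k] ofTree B :=
  have h : (treeData k α).comul (Finsupp.single T 1) = sumSplits T fun A B =>
      (Finsupp.single A 1 : KLT k α) ⊗ₜ[k] (Finsupp.single B 1 : KLT k α) := by
    refine (Finsupp.linearCombination_single k (1 : k) T).trans ?_
    rw [one_smul]; rfl
  h

theorem counit_ofTree_one : counit (R := k) (ofTree one : TreeAlgebra k α) = 1 :=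
  Finsupp.single_eq_same

theorem counit_ofTree_cons (a : α) (C T : OTree α) :
    counit (R := k) (ofTree (cons a C T) : TreeAlgebra k α) = 0 :=
  Finsupp.single_eq_of_ne (by simp)

theorem sumSplits_tmul {V W : Type*} [AddCommGroup V] [Module k V] [AddCommGroup W] [Module k W]
    (T : OTree α) (f : OTree α → OTree α → V) (w : W) :
    sumSplits T f ⊗ₜ[k] w = sumSplits T fun A B => f A B ⊗ₜ[k] w :=
  map_listSum ((TensorProduct.mk k V W).flip w) _ _

theorem tmul_sumSplits {V W : Type*} [AddCommGroup V] [Module k V] [AddCommGroup W] [Module k W]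
    (T : OTree α) (f : OTree α → OTree α → W) (x : V) :
    x ⊗ₜ[k] sumSplits T f = sumSplits T fun A B => x ⊗ₜ[k] f A B :=
  map_listSum (TensorProduct.mk k V W x) _ _

theorem map_sumSplits {V W : Type*} [AddCommGroup V] [Module k V] [AddCommGroup W] [Module k W]
    (g : V →ₗ[k] W) (T : OTree α) (f : OTree α → OTree α → V) :
    g (sumSplits T f) = sumSplits T fun A B => g (f A B) :=
  map_listSum g _ _

instance : Coalgebra k (TreeAlgebra k α) where
  coassoc := linearMap_ext fun T => by
    simp only [LinearMap.comp_apply, comul_ofTree, map_sumSplits,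
      LinearMap.rTensor_tmul, LinearMap.lTensor_tmul, sumSplits_tmul, tmul_sumSplits]
    exact sumSplits_coassoc T fun A B C => (ofTree A : TreeAlgebra k α) ⊗ₜ[k]
      ((ofTree B : TreeAlgebra k α) ⊗ₜ[k] (ofTree C : TreeAlgebra k α))
  rTensor_counit_comp_comul := linearMap_ext fun T => by
    simp only [LinearMap.comp_apply, comul_ofTree, map_sumSplits, LinearMap.rTensor_tmul]
    rw [sumSplits_of_left, counit_ofTree_one, TensorProduct.mk_apply]
    intro a C T U
    rw [counit_ofTree_cons, TensorProduct.zero_tmul]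
  lTensor_counit_comp_comul := linearMap_ext fun T => by
    simp only [LinearMap.comp_apply, comul_ofTree, map_sumSplits, LinearMap.lTensor_tmul]
    rw [sumSplits_of_right, counit_ofTree_one, LinearMap.flip_apply, TensorProduct.mk_apply]
    intro a C T U
    rw [counit_ofTree_cons, TensorProduct.tmul_zero]

theorem comul_mul (x y : TreeAlgebra k α) :
    comul (R := k) (x * y) = comul (R := k) x * comul (R := k) y := by
  induction x using induction with
  | hadd x x' hx hx' => simp only [map_add, add_mul, hx, hx']
  | hsmul c x hx => simp only [map_smul, smul_mul_assoc, hx]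
  | htree F =>
  induction y using induction with
  | hadd x x' hx hx' => simp only [map_add, mul_add, hx, hx']
  | hsmul c x hx => simp only [map_smul, mul_smul_comm, hx]
  | htree T =>
  have h₁ (A B A' B' : OTree α) :
      (ofTree A * ofTree A' : TreeAlgebra k α) ⊗ₜ[k] (ofTree B * ofTree B' : TreeAlgebra k α) =
        sumGraft A A' fun C => sumGraft B B' fun D => ofTree C ⊗ₜ[k] ofTree D := by
    rw [ofTree_mul, ofTree_mul]
    refine (map_listSum ((TensorProduct.mk k (TreeAlgebra k α) (TreeAlgebra k α)).flip _)
      _ _).trans ?_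
    refine congrArg _ (funext fun C => ?_)
    exact map_listSum (TensorProduct.mk k (TreeAlgebra k α) (TreeAlgebra k α) (ofTree C)) _ _
  have h₂ : comul (R := k) (ofTree F * ofTree T : TreeAlgebra k α) =
      sumGraft F T fun A => comul (R := k) (ofTree A : TreeAlgebra k α) := by
    rw [ofTree_mul]; exact map_listSum _ _ _
  have h₃ (z : TreeAlgebra k α ⊗[k] TreeAlgebra k α) :
      (sumSplits F fun A B => ofTree A ⊗ₜ[k] ofTree B) * z =
        sumSplits F fun A B => (ofTree A ⊗ₜ[k] ofTree B) * z :=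
    map_sumSplits (LinearMap.mulRight k z) _ _
  have h₄ (z : TreeAlgebra k α ⊗[k] TreeAlgebra k α) :
      z * (sumSplits T fun A B => ofTree A ⊗ₜ[k] ofTree B) =
        sumSplits T fun A B => z * (ofTree A ⊗ₜ[k] ofTree B) :=
    map_sumSplits (LinearMap.mulLeft k z) _ _
  rw [h₂, comul_ofTree, comul_ofTree, h₃]
  simp only [h₄, Algebra.TensorProduct.tmul_mul_tmul, h₁, comul_ofTree]
  exact sumGraft_sumSplits F T _

theorem counit_sumInner (T F : OTree α) :
    sumInner T F (fun A => counit (R := k) (ofTree A : TreeAlgebra k α)) =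
      counit (R := k) (ofTree F : TreeAlgebra k α) *
        counit (R := k) (ofTree T : TreeAlgebra k α) := by
  cases T with
  | one =>
    cases F with
    | one => rw [sumInner_one_one, counit_ofTree_one, mul_one]
    | cons a C T => rw [sumInner_one_cons, counit_ofTree_cons, zero_mul]
  | cons a C T =>
    simp only [sumInner_cons, sumGraft_eq, counit_ofTree_cons, sumInner_zero, sumSplits_zero,
      mul_zero]

theorem counit_mul (x y : TreeAlgebra k α) :
    counit (R := k) (x * y) = counit (R := k) x * counit (R := k) y := by
  induction x using induction with
  | hadd x x' hx hx' => simp only [map_add, add_mul, hx, hx']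
  | hsmul c x hx => simp only [map_smul, smul_mul_assoc, hx]
  | htree F =>
  induction y using induction with
  | hadd x x' hx hx' => simp only [map_add, mul_add, hx, hx']
  | hsmul c x hx => simp only [map_smul, mul_smul_comm, hx]
  | htree T =>
  rw [ofTree_mul]
  refine (map_listSum (counit (R := k) (A := TreeAlgebra k α)) _ _).trans ?_
  refine (sumGraft_eq F T _).trans ?_
  rw [sumSplits_of_left, ← counit_sumInner]; · rfl
  intro a C A B
  simp only [OTree.join, counit_ofTree_cons, sumInner_zero]

instance : Bialgebra k (TreeAlgebra k α) :=
  Bialgebra.mk' k (TreeAlgebra k α) counit_ofTree_one (counit_mul _ _)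
    ((comul_ofTree one).trans (sumSplits_one _)) (comul_mul _ _)

/-- Trees whose root has one child are primitive. -/
theorem comul_planted (a : α) (C : OTree α) :
    comul (R := k) (ofTree (cons a C one) : TreeAlgebra k α) =
      ofTree (cons a C one) ⊗ₜ[k] 1 + 1 ⊗ₜ[k] ofTree (cons a C one) := by
  rw [comul_ofTree, sumSplits_cons, sumSplits_one]; rfl

/-- `B(C) T = t(B(C), T) + B(C) ▷ T` for a tree `B(C)` whose root has one child. -/
theorem planted_mul (a : α) (C T : OTree α) :
    (ofTree (cons a C one) * ofTree T : TreeAlgebra k α) =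
      ofTree (cons a C T) + sumInner T (cons a C one) ofTree := by
  rw [ofTree_mul, sumGraft_eq, sumSplits_cons, sumSplits_one, sumInner_right_one]; rfl

end TreeAlgebra

/-- Primitive elements of a bialgebra. -/
def IsPrimitive (k : Type u) {H : Type w} [Field k] [Ring H] [Bialgebra k H] (x : H) : Prop :=
  Coalgebra.comul (R := k) x = x ⊗ₜ[k] 1 + 1 ⊗ₜ[k] x

/-! ### Generation by planted trees, and the antipode -/

namespace OTree

variable {α : Type*}

/-- The number of children of the root. -/
def width : OTree α → ℕ
  | one => 0
  | cons _ _ T => width T + 1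

/-- Linking off the root never adds a child to the root. This bounds the correction term in
`planted_mul`. -/
theorem width_of_mem_inner {T F A : OTree α} (h : A ∈ inner T F) : A.width = T.width := by
  induction T generalizing F A with
  | one =>
    cases F with
    | one => rw [List.mem_singleton.1 h]
    | cons a C T => cases h
  | cons a C T _ ih =>
    simp only [inner, List.mem_flatMap, List.mem_map] at h
    obtain ⟨p, -, q, -, C', -, T', hT', rfl⟩ := h
    rw [width, width, ih hT']

theorem width_of_mem_splits {T : OTree α} {p : OTree α × OTree α} (h : p ∈ splits T) :
    p.1.width + p.2.width = T.width := by
  induction T generalizing p with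
  | one => rw [List.mem_singleton.1 h]; rfl
  | cons a C T _ ih =>
    simp only [splits, List.mem_flatMap] at h
    obtain ⟨q, hq, hp⟩ := h
    have := ih hq
    simp only [List.mem_cons, List.not_mem_nil, or_false] at hp
    obtain rfl | rfl := hp <;> simp only [width] <;> omega

theorem listSum_congr {β M : Type*} [AddCommMonoid M] {l : List β} {f g : β → M}
    (h : ∀ x ∈ l, f x = g x) : listSum l f = listSum l g := by
  rw [listSum, listSum, List.map_congr_left h]

theorem listSum_induction {β M : Type*} [AddCommMonoid M] {p : M → Prop} (hzero : p 0)
    (hadd : ∀ x y, p x → p y → p (x + y)) {l : List β} {f : β → M}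
    (h : ∀ x ∈ l, p (f x)) : p (listSum l f) := by
  induction l with
  | nil => exact hzero
  | cons a l ih =>
    exact hadd _ _ (h a List.mem_cons_self) (ih fun x hx => h x (List.mem_cons_of_mem a hx))

end OTree

namespace TreeAlgebra

open OTree Coalgebra WithConv

variable {k : Type u} [Field k] {α : Type v}

theorem isPrimitive_planted (a : α) (C : OTree α) :
    IsPrimitive k (ofTree (cons a C one) : TreeAlgebra k α) := comul_planted a C

/-- The algebra of trees is generated by the trees whose root has one child. -/
theorem planted_induction {p : TreeAlgebra k α → Prop} (hadd : ∀ x y, p x → p y → p (x + y))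
    (hsmul : ∀ (c : k) x, p x → p (c • x)) (hone : p 1)
    (hmul : ∀ a C x, p x → p (ofTree (cons a C one) * x)) (x : TreeAlgebra k α) : p x := by
  refine induction hadd hsmul (fun T => ?_) x
  suffices h : ∀ n (T : OTree α), T.width = n → p (ofTree T) from h _ T rfl
  intro n
  induction n with
  | zero =>
    intro T hT
    cases T with
    | one => exact hone
    | cons a C T => cases hT
  | succ n ih =>
    intro T hT
    cases T with
    | one => cases hT
    | cons a C T =>
      have hT : T.width = n := Nat.succ.inj hT
      -- By `planted_mul`, the tree is a product with right factor `T`, minus trees that have just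
      -- as many nodes as `cons a C T` but only the width `n` of `T`. Induction on the width
      -- therefore works where the number of nodes would not decrease.
      rw [← add_sub_cancel_right (ofTree (cons a C T)) (sumInner T (cons a C one) ofTree),
        ← planted_mul, sub_eq_add_neg, ← neg_one_smul k]
      refine hadd _ _ (hmul a C _ (ih T hT)) (hsmul _ _ ?_)
      refine listSum_induction ?_ hadd fun A hA => ih A ((width_of_mem_inner hA).trans hT)
      have := hsmul 0 _ hone
      rwa [zero_smul] at this

theorem adjoin_isPrimitive :
    Algebra.adjoin k {x : TreeAlgebra k α | IsPrimitive k x} = ⊤ := by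
  refine top_le_iff.1 fun x _ => ?_
  refine planted_induction
    (p := fun x => x ∈ Algebra.adjoin k {x : TreeAlgebra k α | IsPrimitive k x})
    (fun x y hx hy => add_mem hx hy) (fun c x hx => Subalgebra.smul_mem _ hx c)
    (one_mem _) (fun a C x hx => mul_mem (Algebra.subset_adjoin ?_) hx) x
  exact isPrimitive_planted a C

variable (k α) in
/-- The convolution algebra of the endomorphisms of `k{LT(α)}`. -/
abbrev ConvEnd : Type (max u v) := WithConv (TreeAlgebra k α →ₗ[k] TreeAlgebra k α)

theorem convEnd_ext {f g : ConvEnd k α} (h : ∀ T, f (ofTree T) = g (ofTree T)) : f = g :=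
  WithConv.ext (linearMap_ext h)

theorem convMul_ofTree (f g : ConvEnd k α) (T : OTree α) :
    (f * g) (ofTree T) = sumSplits T fun A B => f (ofTree A) * g (ofTree B) := by
  rw [LinearMap.convMul_apply, comul_ofTree, map_sumSplits, map_sumSplits]
  rfl

variable (k α) in
/-- The element `ηε - id` of the convolution algebra. -/
def augConv : ConvEnd k α := 1 - toConv LinearMap.id

theorem augConv_one : augConv k α (ofTree one) = 0 := by
  change algebraMap k (TreeAlgebra k α) (counit (R := k) (ofTree one : TreeAlgebra k α)) -
    ofTree one = 0
  rw [counit_ofTree_one, map_one, one_def, sub_self]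

/-- `ηε - id` vanishes on the one-node tree, so in an iterated coproduct each of the `n` factors
must receive a child of the root. With fewer than `n` children this is impossible. -/
theorem augConv_pow {n : ℕ} {T : OTree α} (h : T.width < n) :
    (augConv k α ^ n) (ofTree T) = 0 := by
  induction n generalizing T with
  | zero => omega
  | succ n ih =>
    rw [pow_succ', convMul_ofTree]
    refine listSum_induction (M := TreeAlgebra k α) (p := fun z => z = 0) rfl
      (fun x y hx hy => by rw [hx, hy, add_zero]) fun p hp => ?_
    have hw := width_of_mem_splits hp
    obtain ⟨A, B⟩ := p
    change augConv k α (ofTree A) * (augConv k α ^ n) (ofTree B) = 0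
    cases A with
    | one => rw [augConv_one, zero_mul]
    | cons a C A =>
      simp only [width] at hw
      rw [ih (T := B) (by omega), mul_zero]

variable (k α) in
/-- The partial sums of the geometric series for the convolution inverse of the identity. -/
def geomConv (n : ℕ) : ConvEnd k α := ∑ i ∈ Finset.range n, augConv k α ^ i

theorem geomConv_eq {n : ℕ} {T : OTree α} (h : T.width < n) :
    geomConv k α n (ofTree T) = geomConv k α (T.width + 1) (ofTree T) := by
  induction n, h using Nat.le_induction with
  | base => rfl
  | succ n hn ih =>
    rw [← ih, geomConv, Finset.sum_range_succ]
    change geomConv k α n (ofTree T) + (augConv k α ^ n) (ofTree T) = _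
    rw [augConv_pow hn, add_zero]

theorem one_sub_augConv_pow {n : ℕ} {T : OTree α} (h : T.width < n) :
    (1 - augConv k α ^ n) (ofTree T) = (1 : ConvEnd k α) (ofTree T) := by
  change (1 : ConvEnd k α) (ofTree T) - (augConv k α ^ n) (ofTree T) = _
  rw [augConv_pow h, sub_zero]

variable (k α) in
/-- The antipode of `k{LT(α)}`. -/
def antipodeHom : TreeAlgebra k α →ₗ[k] TreeAlgebra k α :=
  (Finsupp.linearCombination k fun T : OTree α =>
    (geomConv k α (T.width + 1) (ofTree T) : TreeAlgebra k α) :)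

theorem antipodeHom_ofTree (T : OTree α) {n : ℕ} (h : T.width < n) :
    antipodeHom k α (ofTree T) = geomConv k α n (ofTree T) :=
  ((Finsupp.linearCombination_single k (1 : k) T).trans (one_smul _ _)).trans (geomConv_eq h).symm

theorem antipodeHom_mul_id : (toConv (antipodeHom k α) * toConv LinearMap.id : ConvEnd k α) = 1 :=
  convEnd_ext fun T => by
    -- Geometric series: for `x = 1 - id`, `(∑ i ≤ w, x ^ i) (1 - x) = 1 - x ^ (w + 1)`, and the
    -- last power vanishes at `T`. Parts of `T` are no wider than `T`, so the same truncation
    -- computes the antipode on all of them.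
    have h : (1 : ConvEnd k α) - augConv k α ^ (T.width + 1) =
        geomConv k α (T.width + 1) * toConv LinearMap.id := by
      rw [geomConv, ← geom_sum_mul_neg, augConv, sub_sub_cancel]
    rw [← one_sub_augConv_pow T.width.lt_succ_self, h, convMul_ofTree, convMul_ofTree]
    refine listSum_congr fun p hp => ?_
    have hw := width_of_mem_splits hp
    exact congrArg (· * (ofTree p.2 : TreeAlgebra k α)) (antipodeHom_ofTree p.1 (by omega))

theorem id_mul_antipodeHom : (toConv LinearMap.id * toConv (antipodeHom k α) : ConvEnd k α) = 1 :=
  convEnd_ext fun T => by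
    have h : (1 : ConvEnd k α) - augConv k α ^ (T.width + 1) =
        toConv LinearMap.id * geomConv k α (T.width + 1) := by
      rw [geomConv, ← mul_neg_geom_sum, augConv, sub_sub_cancel]
    rw [← one_sub_augConv_pow T.width.lt_succ_self, h, convMul_ofTree, convMul_ofTree]
    refine listSum_congr fun p hp => ?_
    have hw := width_of_mem_splits hp
    exact congrArg ((ofTree p.1 : TreeAlgebra k α) * ·) (antipodeHom_ofTree p.2 (by omega))

instance : HopfAlgebra k (TreeAlgebra k α) :=
  HopfAlgebra.ofConvInverse (antipodeHom k α) antipodeHom_mul_id id_mul_antipodeHom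

end TreeAlgebra

/-! ## Smash products with Hopf algebras generated by primitive elements -/

section Primitive

variable {k : Type u} {H : Type w} [Field k] [Ring H]

/-- The counit law gives `ε(x) 1 + x = x`, so `ε(x) 1 = 0`. Applying `ε` once more gives the claim
without assuming that `H` is nontrivial. -/
theorem IsPrimitive.counit_eq_zero [Bialgebra k H] {x : H} (hx : IsPrimitive k x) :
    Coalgebra.counit (R := k) x = 0 := by
  have h := Coalgebra.rTensor_counit_comul (R := k) x
  rw [hx, map_add, LinearMap.rTensor_tmul, LinearMap.rTensor_tmul, Bialgebra.counit_one,
    add_eq_right] at h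
  have h' := congrArg (TensorProduct.lid k H) h
  rw [TensorProduct.lid_tmul, map_zero] at h'
  have h'' := congrArg (Coalgebra.counit (R := k)) h'
  rwa [map_smul, Bialgebra.counit_one, smul_eq_mul, mul_one, map_zero] at h''

theorem IsPrimitive.antipode_eq_neg [HopfAlgebra k H] {x : H} (hx : IsPrimitive k x) :
    HopfAlgebra.antipode k x = -x := by
  have h := HopfAlgebra.mul_antipode_rTensor_comul_apply (R := k) x
  rw [hx, hx.counit_eq_zero] at h
  simp only [map_add, LinearMap.rTensor_tmul, LinearMap.mul'_apply, HopfAlgebra.antipode_one,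
    mul_one, one_mul, map_zero] at h
  exact eq_neg_of_add_eq_zero_left h

/-- The elements whose left multiplication preserves `p` are closed under sums, products and
scalars. It therefore suffices to multiply on the left by generators. -/
theorem adjoin_left_induction [Algebra k H] {X : Set H} (hX : Algebra.adjoin k X = ⊤)
    {p : H → Prop} (hadd : ∀ x y, p x → p y → p (x + y)) (hsmul : ∀ (c : k) x, p x → p (c • x))
    (hone : p 1) (hmul : ∀ x h, x ∈ X → p h → p (x * h)) (h : H) : p h := by
  have key : ∀ a : H, a ∈ Algebra.adjoin k X → ∀ h, p h → p (a * h) := by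
    intro a ha
    induction ha using Algebra.adjoin_induction with
    | mem x hx => exact fun h hh => hmul x h hx hh
    | algebraMap c =>
      intro h hh
      rw [← Algebra.smul_def]; exact hsmul c h hh
    | add x y _ _ hx hy =>
      intro h hh
      rw [add_mul]; exact hadd _ _ (hx h hh) (hy h hh)
    | mul x y _ _ hx hy =>
      intro h hh
      rw [mul_assoc]; exact hx _ (hy h hh)
  have := key h (hX ▸ Algebra.mem_top) 1 hone
  rwa [mul_one] at this

theorem primitive_induction [Bialgebra k H] (hH : Algebra.adjoin k {x : H | IsPrimitive k x} = ⊤)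
    {p : H → Prop} (hadd : ∀ x y, p x → p y → p (x + y)) (hsmul : ∀ (c : k) x, p x → p (c • x))
    (hone : p 1) (hmul : ∀ x h, IsPrimitive k x → p h → p (x * h)) (h : H) : p h :=
  adjoin_left_induction hH hadd hsmul hone hmul h

/-- An antipode on a bialgebra generated by primitive elements. -/
abbrev hopfAlgebraOfPrimitive [Bialgebra k H] {X : Set H} (hX : ∀ x ∈ X, IsPrimitive k x)
    (hgen : Algebra.adjoin k X = ⊤) (S : H →ₗ[k] H) (hone : S 1 = 1)
    (hmul : ∀ x ∈ X, ∀ h, S (x * h) = -(S h * x)) : HopfAlgebra k H where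
  antipode := S
  mul_antipode_rTensor_comul := by
    ext h
    change LinearMap.mul' k H (S.rTensor H (Coalgebra.comul h)) =
      algebraMap k H (Coalgebra.counit (R := k) h)
    induction h using adjoin_left_induction hgen with
    | hadd x y hx hy => simp only [map_add, hx, hy]
    | hsmul c x hx => simp only [map_smul, hx, Algebra.algebraMap_eq_smul_one, smul_assoc]
    | hone => simp [Algebra.TensorProduct.one_def, hone]
    -- On every `a ⊗ b` the two terms `S(xa) b` and `S(a) x b` cancel.
    | hmul x h hx _ =>
      rw [Bialgebra.counit_mul, (hX x hx).counit_eq_zero, zero_mul, map_zero,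
        Bialgebra.comul_mul, hX x hx]
      generalize (Coalgebra.comul h : H ⊗[k] H) = z
      induction z with
      | zero => simp
      | add y y' hy hy' => simp only [map_add, mul_add, hy, hy', add_zero]
      | tmul a b => simp [add_mul, hmul x hx, mul_assoc]
  mul_antipode_lTensor_comul := by
    ext h
    change LinearMap.mul' k H (S.lTensor H (Coalgebra.comul h)) =
      algebraMap k H (Coalgebra.counit (R := k) h)
    induction h using adjoin_left_induction hgen with
    | hadd x y hx hy => simp only [map_add, hx, hy]
    | hsmul c x hx => simp only [map_smul, hx, Algebra.algebraMap_eq_smul_one, smul_assoc]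
    | hone => simp [Algebra.TensorProduct.one_def, hone]
    | hmul x h hx hh =>
      -- Here no termwise cancellation occurs: what remains is the commutator of `x` with `∑ a
      -- S(b)`, which is a scalar by the induction hypothesis.
      have key : ∀ z : H ⊗[k] H,
          LinearMap.mul' k H (S.lTensor H ((x ⊗ₜ[k] 1 + 1 ⊗ₜ[k] x) * z)) =
            x * LinearMap.mul' k H (S.lTensor H z) - LinearMap.mul' k H (S.lTensor H z) * x := by
        intro z
        induction z with
        | zero => simp
        | add y y' hy hy' => rw [mul_add, map_add, map_add, map_add, map_add, hy, hy', mul_add, add_mul]; abel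
        | tmul a b => simp [add_mul, hmul x hx, mul_assoc, sub_eq_add_neg]
      rw [Bialgebra.counit_mul, (hX x hx).counit_eq_zero, zero_mul, map_zero,
        Bialgebra.comul_mul, hX x hx, key, hh, Algebra.commutes, sub_self]

end Primitive

/-! ### The smash product as an `R/k`-algebra -/

namespace Smash

open Coalgebra TensorProduct

section Bialgebra

variable {k : Type u} {R : Type v} {H : Type w} [Field k] [CommRing R] [Algebra k R]
  [Ring H] [Bialgebra k H] {act : H →ₗ[k] Module.End k R}

variable (act) in
/-- The smash product `R # H`. -/
abbrev data : RkData k R (R ⊗[k] H) := smash (BialgData.of k H) act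

variable (act) in
/-- Left multiplication by `1 # h`. -/
def lmul (h : H) : R ⊗[k] H →ₗ[k] R ⊗[k] H :=
  TensorProduct.map₂ act (LinearMap.mul k H) (comul h)

theorem data_mul_tmul (r : R) (h : H) (y : R ⊗[k] H) :
    (data act).mul (r ⊗ₜ h) y = r • lmul act h y := rfl

theorem data_incl (r : R) : (data act).incl r = r ⊗ₜ[k] (1 : H) := rfl

theorem data_comul_tmul (r : R) (h : H) :
    (data act).comul (r ⊗ₜ h) =
      AlgebraTensorModule.distribBaseChange k R H H (r ⊗ₜ[k] comul h) := rfl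

theorem data_counit_tmul (r : R) (h : H) :
    (data act).counit (r ⊗ₜ h) = counit (R := k) h • r := rfl

theorem act_prim (hact : IsModuleAlgebra (BialgData.of k H) act) {x : H} (hx : IsPrimitive k x)
    (r s : R) : act x (r * s) = act x r * s + r * act x s := by
  have h := hact.act_mul x r s
  have h₁ : (BialgData.of k H).comul x = x ⊗ₜ[k] 1 + 1 ⊗ₜ[k] x := hx
  have h₂ : act 1 = 1 := hact.one_act
  rw [h₁] at h
  simpa only [map_add, LinearMap.add_apply, map₂_apply_tmul, LinearMap.mul'_apply, h₂,
    Module.End.one_apply, TensorProduct.map_tmul] using h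

theorem lmul_prim (hact : IsModuleAlgebra (BialgData.of k H) act) {x : H} (hx : IsPrimitive k x)
    (s : R) (g : H) : lmul act x (s ⊗ₜ g) = act x s ⊗ₜ g + s ⊗ₜ (x * g) := by
  have h₂ : act 1 = 1 := hact.one_act
  rw [lmul, hx]
  simp [h₂]

theorem lmul_add (h h' : H) : lmul act (h + h') = lmul act h + lmul act h' := by
  simp only [lmul, map_add]

theorem lmul_smul (c : k) (h : H) : lmul act (c • h) = c • lmul act h := by
  simp only [lmul, map_smul]

theorem lmul_one (hact : IsModuleAlgebra (BialgData.of k H) act) :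
    lmul act 1 = LinearMap.id := by
  have h₂ : act 1 = 1 := hact.one_act
  ext s g
  simp [lmul, h₂, Algebra.TensorProduct.one_def]

theorem map₂_mul (hact : IsModuleAlgebra (BialgData.of k H) act) (x y : H ⊗[k] H) :
    TensorProduct.map₂ act (LinearMap.mul k H) (x * y) =
      TensorProduct.map₂ act (LinearMap.mul k H) x ∘ₗ
        TensorProduct.map₂ act (LinearMap.mul k H) y := by
  have hm : ∀ h g : H, act (h * g) = act h * act g := hact.mul_act
  induction x with
  | zero => rw [zero_mul, map_zero, LinearMap.zero_comp]
  | add x x' hx hx' => rw [add_mul, map_add, hx, hx', map_add, LinearMap.add_comp]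
  | tmul a b =>
  induction y with
  | zero => rw [mul_zero, map_zero, LinearMap.comp_zero]
  | add x x' hx hx' => rw [mul_add, map_add, hx, hx', map_add, LinearMap.comp_add]
  | tmul c d =>
  ext s g
  simp [hm, mul_assoc]

theorem lmul_mul (hact : IsModuleAlgebra (BialgData.of k H) act) (h h' : H) :
    lmul act (h * h') = lmul act h ∘ₗ lmul act h' := by
  rw [lmul, Bialgebra.comul_mul, map₂_mul hact]; rfl

/-- The commutation rule `x r = r x + x·r`. The inductions over primitive generators below rest on
it. -/
theorem lmul_prim_smul (hact : IsModuleAlgebra (BialgData.of k H) act) {x : H}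
    (hx : IsPrimitive k x) (s : R) (y : R ⊗[k] H) :
    lmul act x (s • y) = act x s • y + s • lmul act x y := by
  induction y with
  | zero => simp
  | add y y' hy hy' => simp only [smul_add, map_add, hy, hy']; abel
  | tmul t g =>
    rw [TensorProduct.smul_tmul', smul_eq_mul, lmul_prim hact hx, lmul_prim hact hx,
      act_prim hact hx, smul_add, TensorProduct.add_tmul]
    simp only [TensorProduct.smul_tmul', smul_eq_mul]
    abel

theorem mul_smul (r : R) (a b : R ⊗[k] H) :
    (data act).mul (r • a) b = r • (data act).mul a b := by
  induction a with
  | zero => simp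
  | add y y' hy hy' => simp only [smul_add, map_add, LinearMap.add_apply, hy, hy']
  | tmul t g =>
    rw [TensorProduct.smul_tmul', data_mul_tmul, data_mul_tmul, smul_assoc]

/-- Associativity for a left factor `1 # h`. For primitive `h` and `a = s # g` both sides are
expanded by the commutation rule; products of primitives follow from `lmul_mul`. General
associativity is an `R`-multiple of this. -/
theorem lmul_data_mul (hact : IsModuleAlgebra (BialgData.of k H) act)
    (hH : Algebra.adjoin k {x : H | IsPrimitive k x} = ⊤) (h : H) (a b : R ⊗[k] H) :
    (data act).mul (lmul act h a) b = lmul act h ((data act).mul a b) := by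
  induction h using primitive_induction hH generalizing a with
  | hadd x y hx hy => simp only [lmul_add, LinearMap.add_apply, map_add, hx, hy]
  | hsmul c x hx => simp only [lmul_smul, LinearMap.smul_apply, map_smul, hx]
  | hone => rw [lmul_one hact]; rfl
  | hmul x h hx hh =>
    rw [lmul_mul hact, LinearMap.comp_apply, LinearMap.comp_apply, ← hh]
    generalize lmul act h a = a
    induction a with
    | zero => simp
    | add y y' hy hy' => simp only [map_add, LinearMap.add_apply, hy, hy']
    | tmul s g =>
      rw [lmul_prim hact hx, map_add, LinearMap.add_apply, data_mul_tmul, data_mul_tmul,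
        data_mul_tmul, lmul_prim_smul hact hx, lmul_mul hact]
      rfl

theorem mul_assoc (hact : IsModuleAlgebra (BialgData.of k H) act)
    (hH : Algebra.adjoin k {x : H | IsPrimitive k x} = ⊤) (a b c : R ⊗[k] H) :
    (data act).mul ((data act).mul a b) c = (data act).mul a ((data act).mul b c) := by
  induction a with
  | zero => simp
  | add y y' hy hy' => simp only [map_add, LinearMap.add_apply, hy, hy']
  | tmul r h => rw [data_mul_tmul, data_mul_tmul, mul_smul, lmul_data_mul hact hH]

theorem lmul_one_tmul (hact : IsModuleAlgebra (BialgData.of k H) act) (h g : H) :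
    lmul act h ((1 : R) ⊗ₜ g) = 1 ⊗ₜ (h * g) := by
  have h₁ : ∀ h : H, act h 1 = algebraMap k R (counit (R := k) h) := hact.act_one
  have key : ∀ z : H ⊗[k] H, TensorProduct.map₂ act (LinearMap.mul k H) z ((1 : R) ⊗ₜ g) =
      1 ⊗ₜ (TensorProduct.lid k H (counit.rTensor H z) * g) := by
    intro z
    induction z with
    | zero => simp
    | add y y' hy hy' => simp only [map_add, LinearMap.add_apply, hy, hy', add_mul, tmul_add]
    | tmul a b =>
      simp [h₁, Algebra.algebraMap_eq_smul_one, TensorProduct.smul_tmul]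
  rw [lmul, key, rTensor_counit_comul]
  simp

theorem isRkAlgebra (hact : IsModuleAlgebra (BialgData.of k H) act)
    (hH : Algebra.adjoin k {x : H | IsPrimitive k x} = ⊤) : IsRkAlgebra (data act) where
  mul_assoc := mul_assoc hact hH
  one_mul b := by rw [data_incl, data_mul_tmul, lmul_one hact, one_smul]; rfl
  mul_one b := by
    induction b with
    | zero => simp
    | add y y' hy hy' => simp only [map_add, LinearMap.add_apply, hy, hy']
    | tmul r h =>
      rw [data_incl, data_mul_tmul, lmul_one_tmul hact, _root_.mul_one, TensorProduct.smul_tmul',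
        smul_eq_mul, _root_.mul_one]
  incl_mul r s := by
    rw [data_incl, data_incl, data_incl, data_mul_tmul, lmul_one hact]; rfl
  incl_injective := by
    refine Function.LeftInverse.injective (g := (data act).counit) fun r => ?_
    rw [data_incl, data_counit_tmul, Bialgebra.counit_one, one_smul]
  smul_eq r b := by rw [data_incl, data_mul_tmul, lmul_one hact]; rfl

end Bialgebra

end Smash

/-- The additive map on a tensor product given by a balanced biadditive function. -/
def liftBalanced {A M N P : Type*} [CommRing A] [AddCommGroup M] [AddCommGroup N] [AddCommGroup P]
    [Module A M] [Module A N] (f : M → N → P) (h₁ : ∀ m m' n, f (m + m') n = f m n + f m' n)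
    (h₂ : ∀ m n n', f m (n + n') = f m n + f m n')
    (h₃ : ∀ (a : A) m n, f (a • m) n = f m (a • n)) : M ⊗[A] N →+ P :=
  TensorProduct.liftAddHom
    (AddMonoidHom.mk' (fun m => AddMonoidHom.mk' (f m) (h₂ m))
      fun m m' => AddMonoidHom.ext fun n => h₁ m m' n) h₃

theorem liftBalanced_tmul {A M N P : Type*} [CommRing A] [AddCommGroup M] [AddCommGroup N]
    [AddCommGroup P] [Module A M] [Module A N] (f : M → N → P)
    (h₁ : ∀ m m' n, f (m + m') n = f m n + f m' n)
    (h₂ : ∀ m n n', f m (n + n') = f m n + f m n')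
    (h₃ : ∀ (a : A) m n, f (a • m) n = f m (a • n)) (m : M) (n : N) :
    liftBalanced f h₁ h₂ h₃ (m ⊗ₜ n) = f m n :=
  TensorProduct.liftAddHom_tmul _ _ _ _

/-! ### The smash product as an `R/k`-bialgebra -/

namespace Smash

open Coalgebra TensorProduct

section Bialgebra

variable {k : Type u} {R : Type v} {H : Type w} [Field k] [CommRing R] [Algebra k R]
  [Ring H] [Bialgebra k H] {act : H →ₗ[k] Module.End k R}

theorem distribBaseChange_smul (r s : R) (z : H ⊗[k] H) :
    AlgebraTensorModule.distribBaseChange k R H H ((r * s) ⊗ₜ z) =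
      r • AlgebraTensorModule.distribBaseChange k R H H (s ⊗ₜ z) := by
  rw [← map_smul, TensorProduct.smul_tmul', smul_eq_mul]

/-- The coalgebra structure is the base change of that of `H` and does not involve the action, so
its laws are those of a base-changed coalgebra. -/
theorem data_comul_eq : (data act).comul = Coalgebra.comul (R := R) (A := R ⊗[k] H) := by
  ext h
  change (data act).comul (1 ⊗ₜ h) = Coalgebra.comul (R := R) ((1 : R) ⊗ₜ[k] h)
  rw [data_comul_tmul, TensorProduct.comul_tmul]
  generalize (comul h : H ⊗[k] H) = z
  induction z with
  | zero => simp
  | add y y' hy hy' => simp only [map_add, tmul_add, hy, hy']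
  | tmul a b => rfl

theorem data_counit_eq : (data act).counit = Coalgebra.counit (R := R) (A := R ⊗[k] H) := by
  ext h
  rfl

variable (act) in
/-- The map `a ⊗ b ↦ (1 # a) y ⊗ (1 # b) y'`. -/
def lmulTensor (y y' : R ⊗[k] H) : H ⊗[k] H →+ (R ⊗[k] H) ⊗[R] (R ⊗[k] H) :=
  liftBalanced (fun a b => lmul act a y ⊗ₜ[R] lmul act b y')
    (fun _ _ _ => by rw [lmul_add, LinearMap.add_apply, add_tmul])
    (fun _ _ _ => by rw [lmul_add, LinearMap.add_apply, tmul_add])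
    (fun c a b => by
      rw [lmul_smul, lmul_smul, LinearMap.smul_apply, LinearMap.smul_apply,
        ← algebraMap_smul R c (lmul act a y), ← algebraMap_smul R c (lmul act b y'), smul_tmul])

theorem lmulTensor_tmul (y y' : R ⊗[k] H) (a b : H) :
    lmulTensor act y y' (a ⊗ₜ b) = lmul act a y ⊗ₜ[R] lmul act b y' :=
  liftBalanced_tmul _ _ _ _ _ _

theorem act_one_prim (hact : IsModuleAlgebra (BialgData.of k H) act) {x : H}
    (hx : IsPrimitive k x) : act x 1 = 0 := by
  refine (hact.act_one x).trans ?_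
  rw [show (BialgData.of k H).counit x = 0 from hx.counit_eq_zero, map_zero]

/-- `Δ(s # g)` is a sum of terms `(s # a) ⊗ (1 # b)`. As `x·1 = 0`, differentiation of the
coefficient contributes in the first factor only, and this matches the term `x·s` on the left. -/
theorem comul_lmul_prim (hact : IsModuleAlgebra (BialgData.of k H) act) {x : H}
    (hx : IsPrimitive k x) {Ψ : (R ⊗[k] H) ⊗[R] (R ⊗[k] H) →+ (R ⊗[k] H) ⊗[R] (R ⊗[k] H)}
    (hΨ : ∀ y y', Ψ (y ⊗ₜ y') = lmul act x y ⊗ₜ[R] y' + y ⊗ₜ[R] lmul act x y')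
    (c : R ⊗[k] H) : (data act).comul (lmul act x c) = Ψ ((data act).comul c) := by
  induction c with
  | zero => simp only [map_zero]
  | add y y' hy hy' => simp only [map_add, hy, hy']
  | tmul s g =>
    rw [lmul_prim hact hx, map_add, data_comul_tmul, data_comul_tmul, data_comul_tmul,
      Bialgebra.comul_mul, hx]
    generalize (comul g : H ⊗[k] H) = z
    induction z with
    | zero => simp only [mul_zero, tmul_zero, map_zero, add_zero]
    | add y y' hy hy' =>
      simp only [map_add, tmul_add, mul_add, ← hy, ← hy']; abel
    | tmul a b =>
      rw [AlgebraTensorModule.distribBaseChange_tmul, AlgebraTensorModule.distribBaseChange_tmul,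
        hΨ, lmul_prim hact hx, lmul_prim hact hx, act_one_prim hact hx, add_mul, tmul_add, map_add,
        Algebra.TensorProduct.tmul_mul_tmul, Algebra.TensorProduct.tmul_mul_tmul,
        AlgebraTensorModule.distribBaseChange_tmul, AlgebraTensorModule.distribBaseChange_tmul,
        zero_tmul, zero_add, one_mul, one_mul, add_tmul, add_assoc]

/-- The formula `y ⊗ y' ↦ ∑ (1 # h₁) y ⊗ (1 # h₂) y'` is not visibly balanced over `R`; in general
this requires cocommutativity. The induction therefore carries along the existence of the map `Ψ` on
`B ⊗_R B`, which for `x h` is the composite of the maps for `x` and `h`. -/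
theorem exists_comul_lmul (hact : IsModuleAlgebra (BialgData.of k H) act)
    (hH : Algebra.adjoin k {x : H | IsPrimitive k x} = ⊤) (h : H) :
    ∃ Ψ : (R ⊗[k] H) ⊗[R] (R ⊗[k] H) →+ (R ⊗[k] H) ⊗[R] (R ⊗[k] H),
      (∀ y y', Ψ (y ⊗ₜ y') = lmulTensor act y y' (comul h)) ∧
      ∀ c, (data act).comul (lmul act h c) = Ψ ((data act).comul c) := by
  have hone : lmul act (1 : H) = LinearMap.id := lmul_one hact
  induction h using primitive_induction hH with
  | hadd x y hx hy =>
    obtain ⟨Ψ, h₁, h₂⟩ := hx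
    obtain ⟨Ψ', h₁', h₂'⟩ := hy
    refine ⟨Ψ + Ψ', fun y y' => ?_, fun c => ?_⟩
    · rw [AddMonoidHom.add_apply, h₁, h₁', map_add, map_add]
    · rw [AddMonoidHom.add_apply, ← h₂, ← h₂', lmul_add, LinearMap.add_apply, map_add]
  | hsmul c x hx =>
    obtain ⟨Ψ, h₁, h₂⟩ := hx
    refine ⟨(DistribSMul.toAddMonoidHom _ (algebraMap k R c)).comp Ψ, fun y y' => ?_, fun z => ?_⟩
    · change algebraMap k R c • Ψ (y ⊗ₜ y') = _
      rw [h₁, map_smul]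
      generalize (comul x : H ⊗[k] H) = z
      induction z with
      | zero => simp only [map_zero, smul_zero]
      | add y y' hy hy' => simp only [map_add, smul_add, hy, hy']
      | tmul a b =>
        rw [TensorProduct.smul_tmul', lmulTensor_tmul, lmulTensor_tmul, lmul_smul,
          LinearMap.smul_apply, TensorProduct.smul_tmul', algebraMap_smul]
    · change _ = algebraMap k R c • Ψ ((data act).comul z)
      rw [← h₂, lmul_smul, LinearMap.smul_apply, ← algebraMap_smul R c (lmul act x z), map_smul]
  | hone =>
    refine ⟨AddMonoidHom.id _, fun y y' => ?_, fun c => ?_⟩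
    · rw [Bialgebra.comul_one, Algebra.TensorProduct.one_def, lmulTensor_tmul, hone]; rfl
    · rw [hone]; rfl
  | hmul x h hx hh =>
    obtain ⟨Ψ', h₁', h₂'⟩ := hh
    -- Neither summand need be balanced on its own. In the sum, the extra term `(x·a) m ⊗ n` appears
    -- on either side of the balancing condition.
    let Ψ : (R ⊗[k] H) ⊗[R] (R ⊗[k] H) →+ (R ⊗[k] H) ⊗[R] (R ⊗[k] H) :=
      liftBalanced (fun y y' => lmul act x y ⊗ₜ[R] y' + y ⊗ₜ[R] lmul act x y')
        (fun m m' n => by simp only [map_add, add_tmul]; abel)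
        (fun m m' n => by simp only [map_add, tmul_add]; abel)
        (fun a m n => by
          rw [lmul_prim_smul hact hx, lmul_prim_smul hact hx, add_tmul, tmul_add, smul_tmul,
            smul_tmul, smul_tmul]
          abel)
    have hΨ : ∀ y y', Ψ (y ⊗ₜ y') = lmul act x y ⊗ₜ[R] y' + y ⊗ₜ[R] lmul act x y' :=
      fun y y' => liftBalanced_tmul _ _ _ _ _ _
    refine ⟨Ψ.comp Ψ', fun y y' => ?_, fun c => ?_⟩
    · rw [AddMonoidHom.comp_apply, h₁', Bialgebra.comul_mul, hx]
      generalize (comul h : H ⊗[k] H) = z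
      induction z with
      | zero => simp only [map_zero, mul_zero]
      | add y y' hy hy' => simp only [map_add, mul_add, hy, hy']
      | tmul a b =>
        rw [lmulTensor_tmul, hΨ, add_mul, map_add, Algebra.TensorProduct.tmul_mul_tmul,
          Algebra.TensorProduct.tmul_mul_tmul, lmulTensor_tmul, lmulTensor_tmul, one_mul,
          one_mul, lmul_mul hact, lmul_mul hact]
        rfl
    · rw [AddMonoidHom.comp_apply, ← h₂', lmul_mul hact]
      exact comul_lmul_prim hact hx hΨ _

variable (act) in
/-- Right multiplication by `y`. -/
def rmul (y : R ⊗[k] H) : R ⊗[k] H →ₗ[R] R ⊗[k] H where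
  toFun b := (data act).mul b y
  map_add' _ _ := LinearMap.map_add₂ _ _ _ _
  map_smul' r b := mul_smul r b y

/-- Right multiplications are `R`-linear, so this form makes sense for every representation of
`Δ(b)`. That the representation of `Δ(c)` is also arbitrary comes from `exists_comul_lmul`. -/
theorem comul_mul_eq_sum (hact : IsModuleAlgebra (BialgData.of k H) act)
    (hH : Algebra.adjoin k {x : H | IsPrimitive k x} = ⊤) (b c : R ⊗[k] H) {m : ℕ}
    (y y' : Fin m → R ⊗[k] H) (hc : (data act).comul c = ∑ j, y j ⊗ₜ[R] y' j) :
    (data act).comul ((data act).mul b c) =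
      ∑ j, TensorProduct.map (rmul act (y j)) (rmul act (y' j)) ((data act).comul b) := by
  induction b with
  | zero => simp
  | add b b' hb hb' =>
    simp only [map_add, LinearMap.add_apply, hb, hb', Finset.sum_add_distrib]
  | tmul r h =>
    rw [data_mul_tmul, map_smul, ← _root_.mul_one r]
    simp only [data_comul_tmul, distribBaseChange_smul, map_smul]
    rw [← Finset.smul_sum, _root_.mul_one]
    congr 1
    obtain ⟨Ψ, h₁, h₂⟩ := exists_comul_lmul hact hH h
    rw [h₂, hc, map_sum]
    refine Finset.sum_congr rfl fun j _ => ?_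
    rw [h₁]
    generalize (comul h : H ⊗[k] H) = z
    induction z with
    | zero => simp only [map_zero, tmul_zero]
    | add y y' hy hy' => simp only [map_add, tmul_add, hy, hy']
    | tmul a b =>
      rw [lmulTensor_tmul, AlgebraTensorModule.distribBaseChange_tmul, TensorProduct.map_tmul]
      change _ = (data act).mul (1 ⊗ₜ a) (y j) ⊗ₜ[R] (data act).mul (1 ⊗ₜ b) (y' j)
      rw [data_mul_tmul, data_mul_tmul, one_smul, one_smul]

/-- Shows that `ε(bc)` depends on `c` only through `ε(c)`, which is the law `ε(bc) = ε(b ε(c))`. -/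
theorem counit_lmul (h : H) (y : R ⊗[k] H) :
    (data act).counit (lmul act h y) = act h ((data act).counit y) := by
  induction y with
  | zero => simp
  | add y y' hy hy' => simp only [map_add, hy, hy']
  | tmul s g =>
    have key : ∀ z : H ⊗[k] H,
        (data act).counit (TensorProduct.map₂ act (LinearMap.mul k H) z (s ⊗ₜ g)) =
          counit (R := k) g • act (TensorProduct.rid k H (counit.lTensor H z)) s := by
      intro z
      induction z with
      | zero => simp
      | add y y' hy hy' => simp only [map_add, LinearMap.add_apply, hy, hy', smul_add]
      | tmul a b =>
        rw [map₂_apply_tmul, TensorProduct.map_tmul, data_counit_tmul, LinearMap.lTensor_tmul,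
          TensorProduct.rid_tmul, LinearMap.mul_apply', Bialgebra.counit_mul, map_smul, LinearMap.smul_apply,
          smul_smul, mul_comm]
    rw [lmul, key, lTensor_counit_comul, TensorProduct.rid_tmul, one_smul, data_counit_tmul, map_smul]

theorem isRkBialgebra (hact : IsModuleAlgebra (BialgData.of k H) act)
    (hH : Algebra.adjoin k {x : H | IsPrimitive k x} = ⊤) : IsRkBialgebra (data act) where
  toIsRkAlgebra := isRkAlgebra hact hH
  coassoc := by rw [data_comul_eq]; exact Coalgebra.coassoc
  counit_left := by
    rw [data_comul_eq, data_counit_eq]; exact Coalgebra.rTensor_counit_comp_comul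
  counit_right := by
    rw [data_comul_eq, data_counit_eq]; exact Coalgebra.lTensor_counit_comp_comul
  comul_one := by
    rw [data_incl, data_comul_tmul, Bialgebra.comul_one, Algebra.TensorProduct.one_def,
      AlgebraTensorModule.distribBaseChange_tmul]
  comul_mul b c n m x x' y y' hb hc := by
    rw [comul_mul_eq_sum hact hH b c y y' hc, hb, Finset.sum_comm]
    refine Finset.sum_congr rfl fun j _ => ?_
    rw [map_sum]
    rfl
  counit_one := by rw [data_incl, data_counit_tmul, Bialgebra.counit_one, one_smul]
  counit_mul b c := by
    induction b with
    | zero => simp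
    | add b b' hb hb' => simp only [map_add, LinearMap.add_apply, hb, hb']
    | tmul r h =>
      rw [data_mul_tmul, data_mul_tmul, map_smul, map_smul, counit_lmul, counit_lmul,
        data_incl, data_counit_tmul, Bialgebra.counit_one, one_smul]

end Bialgebra

end Smash

/-! ### The antiproduct of the smash product -/

namespace Smash

open Coalgebra TensorProduct

section Hopf

variable {k : Type u} {R : Type v} {H : Type w} [Field k] [CommRing R] [Algebra k R]
  [Ring H] [HopfAlgebra k H] {act : H →ₗ[k] Module.End k R}

variable (R H) in
/-- The map `a ⊗ b ↦ (1 # a) ⊗ (1 # b)`. -/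
def inclTensor : H ⊗[k] H →ₗ[k] (R ⊗[k] H) ⊗[k] (R ⊗[k] H) :=
  TensorProduct.map (TensorProduct.mk k R H 1) (TensorProduct.mk k R H 1)

theorem inclTensor_tmul (a b : H) :
    inclTensor R H (a ⊗ₜ[k] b) = (1 ⊗ₜ[k] a) ⊗ₜ[k] (1 ⊗ₜ[k] b) := rfl

variable (k R H) in
/-- The representative `∑ (r # h₁) ⊗ (1 # S(h₂))` of the antiproduct of `r # h`. -/
def antiRep : R ⊗[k] H →ₗ[R] (R ⊗[k] H) ⊗[k] (R ⊗[k] H) :=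
  LinearMap.liftBaseChange R (inclTensor R H ∘ₗ (HopfAlgebra.antipode k).lTensor H ∘ₗ comul)

theorem antiRep_tmul (r : R) (h : H) : antiRep k R H (r ⊗ₜ h) =
    r • inclTensor R H ((HopfAlgebra.antipode k).lTensor H (comul h)) :=
  LinearMap.liftBaseChange_tmul _ _ _ _

variable (act) in
/-- The antiproduct. -/
def antiproduct : R ⊗[k] H →ₗ[R] (data act).BiTensor := (data act).biMk ∘ₗ antiRep k R H

theorem mulRight_smul (c : R ⊗[k] H) (r : R) (z : (R ⊗[k] H) ⊗[k] (R ⊗[k] H)) :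
    (data act).mulRight c (r • z) = r • (data act).mulRight c z := by
  induction z with
  | zero => simp
  | add y y' hy hy' => simp only [smul_add, map_add, hy, hy']
  | tmul a b => rfl

theorem mulRight_tmul (a b c : R ⊗[k] H) :
    (data act).mulRight c (a ⊗ₜ[k] b) = a ⊗ₜ[k] (data act).mul b c := rfl

theorem mulRight_mulRight (hact : IsModuleAlgebra (BialgData.of k H) act)
    (hH : Algebra.adjoin k {x : H | IsPrimitive k x} = ⊤) (c d : R ⊗[k] H)
    (z : (R ⊗[k] H) ⊗[k] (R ⊗[k] H)) :
    (data act).mulRight c ((data act).mulRight d z) =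
      (data act).mulRight ((data act).mul d c) z := by
  induction z with
  | zero => simp
  | add y y' hy hy' => simp only [map_add, hy, hy']
  | tmul a b => rw [mulRight_tmul, mulRight_tmul, mulRight_tmul, mul_assoc hact hH]

theorem mulRight_add (c d : R ⊗[k] H) (z : (R ⊗[k] H) ⊗[k] (R ⊗[k] H)) :
    (data act).mulRight (c + d) z = (data act).mulRight c z + (data act).mulRight d z := by
  rw [RkData.mulRight, map_add, LinearMap.lTensor_add]; rfl

variable (act) in
/-- The relations that define `B ⊗_r B`. -/
def biRel : Submodule R ((R ⊗[k] H) ⊗[k] (R ⊗[k] H)) :=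
  Submodule.span R {z | ∃ (b c : R ⊗[k] H) (r : R),
    z = (data act).mul b ((data act).incl r) ⊗ₜ[k] c - b ⊗ₜ[k] (data act).mul ((data act).incl r) c}

theorem biMk_eq_iff (z z' : (R ⊗[k] H) ⊗[k] (R ⊗[k] H)) :
    (data act).biMk z = (data act).biMk z' ↔ z - z' ∈ biRel act :=
  Submodule.Quotient.eq _

theorem biRel_generator (b c : R ⊗[k] H) (r : R) :
    (data act).mul b ((data act).incl r) ⊗ₜ[k] c - b ⊗ₜ[k] (data act).mul ((data act).incl r) c ∈
      biRel act :=
  Submodule.subset_span ⟨b, c, r, rfl⟩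

theorem biMk_balanced (b c : R ⊗[k] H) (r : R) :
    (data act).biMk ((data act).mul b ((data act).incl r) ⊗ₜ[k] c) =
      (data act).biMk (b ⊗ₜ[k] (data act).mul ((data act).incl r) c) :=
  (biMk_eq_iff _ _).2 (biRel_generator b c r)

/-- An additive map on `B ⊗_k B` that is compatible with the relations of `B ⊗_r B` and with
multiplication by elements of `R`. -/
theorem map_eq_of_biMk_eq {P : Type*} [AddCommGroup P]
    (F : (R ⊗[k] H) ⊗[k] (R ⊗[k] H) →+ P)
    (hsmul : ∀ (r : R) z, F z = 0 → F (r • z) = 0)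
    (hF : ∀ b c r, F ((data act).mul b ((data act).incl r) ⊗ₜ[k] c) =
      F (b ⊗ₜ[k] (data act).mul ((data act).incl r) c))
    {z z' : (R ⊗[k] H) ⊗[k] (R ⊗[k] H)} (h : (data act).biMk z = (data act).biMk z') :
    F z = F z' := by
  rw [biMk_eq_iff] at h
  have key : ∀ w ∈ biRel act, F w = 0 := by
    intro w hw
    induction hw using Submodule.span_induction with
    | mem w hw =>
      obtain ⟨b, c, r, rfl⟩ := hw
      rw [map_sub, hF, sub_self]
    | zero => exact map_zero F
    | add x y _ _ hx hy => rw [map_add, hx, hy, add_zero]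
    | smul r x _ hx => exact hsmul r x hx
  have := key _ h
  rwa [map_sub, sub_eq_zero] at this

theorem biMk_mulRight_congr (hact : IsModuleAlgebra (BialgData.of k H) act)
    (hH : Algebra.adjoin k {x : H | IsPrimitive k x} = ⊤) (c : R ⊗[k] H)
    {z z' : (R ⊗[k] H) ⊗[k] (R ⊗[k] H)} (h : (data act).biMk z = (data act).biMk z') :
    (data act).biMk ((data act).mulRight c z) = (data act).biMk ((data act).mulRight c z') := by
  refine map_eq_of_biMk_eq (act := act)
    ((data act).biMk.toAddMonoidHom.comp ((data act).mulRight c).toAddMonoidHom)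
    (fun r z hz => ?_) (fun b d r => ?_) h
  · change (data act).biMk ((data act).mulRight c z) = 0 at hz
    change (data act).biMk ((data act).mulRight c (r • z)) = 0
    rw [mulRight_smul, map_smul, hz, smul_zero]
  · change (data act).biMk ((data act).mulRight c ((data act).mul b ((data act).incl r) ⊗ₜ[k] d)) =
      (data act).biMk ((data act).mulRight c (b ⊗ₜ[k] (data act).mul ((data act).incl r) d))
    rw [mulRight_tmul, mulRight_tmul, biMk_balanced, mul_assoc hact hH]

theorem rTensor_lmul_smul (hact : IsModuleAlgebra (BialgData.of k H) act) {x : H}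
    (hx : IsPrimitive k x) (r : R) (z : (R ⊗[k] H) ⊗[k] (R ⊗[k] H)) :
    (lmul act x).rTensor (R ⊗[k] H) (r • z) =
      act x r • z + r • (lmul act x).rTensor (R ⊗[k] H) z := by
  induction z with
  | zero => simp
  | add y y' hy hy' => simp only [smul_add, map_add, hy, hy']; abel
  | tmul a b =>
    rw [TensorProduct.smul_tmul', LinearMap.rTensor_tmul, lmul_prim_smul hact hx, add_tmul]
    rfl

/-- Left multiplication by `1 # x` descends to `B ⊗_r B` although it is not `R`-linear: the Leibniz
term `(x·r) z` stays in the `R`-submodule of relations. -/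
theorem biMk_rTensor_congr (hact : IsModuleAlgebra (BialgData.of k H) act)
    (hH : Algebra.adjoin k {x : H | IsPrimitive k x} = ⊤) {x : H} (hx : IsPrimitive k x)
    {z z' : (R ⊗[k] H) ⊗[k] (R ⊗[k] H)} (h : (data act).biMk z = (data act).biMk z') :
    (data act).biMk ((lmul act x).rTensor _ z) = (data act).biMk ((lmul act x).rTensor _ z') := by
  rw [biMk_eq_iff] at h ⊢
  rw [← map_sub]
  generalize z - z' = w at h
  induction h using Submodule.span_induction with
  | mem w hw =>
    obtain ⟨b, c, r, rfl⟩ := hw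
    rw [map_sub, LinearMap.rTensor_tmul, LinearMap.rTensor_tmul, ← lmul_data_mul hact hH]
    exact biRel_generator _ _ _
  | zero => rw [map_zero]; exact zero_mem _
  | add x y _ _ hx hy => rw [map_add]; exact add_mem hx hy
  | smul r x hx' hx'' =>
    rw [rTensor_lmul_smul hact hx]
    exact add_mem (Submodule.smul_mem _ _ hx') (Submodule.smul_mem _ _ hx'')

/-- `E(1 # xh)` is the commutator of `1 # x` with `E(1 # h)`, because `S(xb) = -S(b) x`. -/
theorem antiRep_one_mul (hact : IsModuleAlgebra (BialgData.of k H) act) {x : H}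
    (hx : IsPrimitive k x) (h : H) : antiRep k R H (1 ⊗ₜ (x * h)) =
      (lmul act x).rTensor _ (antiRep k R H (1 ⊗ₜ h)) -
        (data act).mulRight (1 ⊗ₜ x) (antiRep k R H (1 ⊗ₜ h)) := by
  rw [antiRep_tmul, antiRep_tmul, one_smul, one_smul, Bialgebra.comul_mul, hx]
  generalize (comul h : H ⊗[k] H) = z
  induction z with
  | zero => simp
  | add y y' hy hy' => simp only [map_add, mul_add, hy, hy']; abel
  | tmul a b =>
    rw [add_mul, Algebra.TensorProduct.tmul_mul_tmul, Algebra.TensorProduct.tmul_mul_tmul,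
      map_add, map_add, LinearMap.lTensor_tmul, LinearMap.lTensor_tmul, LinearMap.lTensor_tmul,
      inclTensor_tmul, inclTensor_tmul, inclTensor_tmul, LinearMap.rTensor_tmul, mulRight_tmul,
      data_mul_tmul, lmul_one_tmul hact, lmul_one_tmul hact, one_mul, one_mul, one_smul,
      HopfAlgebra.antipode_mul_antidistrib, hx.antipode_eq_neg, mul_neg, tmul_neg, tmul_neg,
      sub_eq_add_neg]

/-- Write `E` for `E(1 # h)` and suppose `E r = r E` for all `r`. Then `(xE - Ex) r = x r E - E (r x
+ x·r)`. Expanding `x r E = r x E + (x·r) E` and using `E (x·r) = (x·r) E` leaves `r (xE - Ex)`. The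
hypothesis is needed for both `r` and `x·r`, hence the generalization over `r`. -/
theorem antiproduct_comm (hact : IsModuleAlgebra (BialgData.of k H) act)
    (hH : Algebra.adjoin k {x : H | IsPrimitive k x} = ⊤) (h : H) (r : R) :
    (data act).biMk ((data act).mulRight ((data act).incl r) (antiRep k R H (1 ⊗ₜ h))) =
      r • (data act).biMk (antiRep k R H (1 ⊗ₜ h)) := by
  induction h using primitive_induction hH generalizing r with
  | hadd x y hx hy => simp only [tmul_add, map_add, smul_add, hx, hy]
  | hsmul c x hx =>
    have : (1 : R) ⊗ₜ[k] (c • x) = algebraMap k R c • ((1 : R) ⊗ₜ[k] x) := by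
      rw [algebraMap_smul, tmul_smul]
    rw [this, map_smul, mulRight_smul, map_smul, map_smul, hx, smul_comm]
  | hone =>
    rw [antiRep_tmul, Bialgebra.comul_one, Algebra.TensorProduct.one_def, LinearMap.lTensor_tmul,
      HopfAlgebra.antipode_one, inclTensor_tmul, one_smul, mulRight_tmul, ← map_smul]
    have h₁ : (data act).mul ((1 : R) ⊗ₜ (1 : H)) ((data act).incl r) =
        (data act).mul ((data act).incl r) ((1 : R) ⊗ₜ (1 : H)) := by
      rw [data_incl, data_mul_tmul, data_mul_tmul, lmul_one hact]
      simp [smul_tmul']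
    rw [h₁, ← biMk_balanced, data_incl, data_mul_tmul, lmul_one hact, one_smul, smul_tmul',
      smul_tmul', smul_eq_mul, _root_.mul_one]
    rfl
  | hmul x h hx hh =>
    have h₁ : (data act).mul ((1 : R) ⊗ₜ x) ((data act).incl r) =
        (data act).incl (act x r) + (data act).mul ((data act).incl r) (1 ⊗ₜ x) := by
      simp only [data_incl, data_mul_tmul, lmul_one hact, lmul_prim hact hx]
      simp [smul_tmul']
    have h₂ := biMk_rTensor_congr hact hH hx
      ((hh r).trans (map_smul (data act).biMk r (antiRep k R H (1 ⊗ₜ h))).symm)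
    have h₃ : (lmul act x).rTensor (R ⊗[k] H)
        ((data act).mulRight ((data act).incl r) (antiRep k R H (1 ⊗ₜ h))) =
        (data act).mulRight ((data act).incl r)
          ((lmul act x).rTensor (R ⊗[k] H) (antiRep k R H (1 ⊗ₜ h))) := by
      generalize antiRep k R H (1 ⊗ₜ h) = z
      exact (LinearMap.congr_fun (LinearMap.rTensor_comp_lTensor _ _ _) z).trans
        (LinearMap.congr_fun (LinearMap.lTensor_comp_rTensor _ _ _) z).symm
    have h₄ := biMk_mulRight_congr hact hH (1 ⊗ₜ x)
      ((hh r).trans (map_smul (data act).biMk r (antiRep k R H (1 ⊗ₜ h))).symm)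
    rw [antiRep_one_mul hact hx, map_sub, map_sub, ← h₃, h₂, mulRight_mulRight hact hH, h₁,
      mulRight_add, map_add, hh, ← mulRight_mulRight hact hH, h₄, rTensor_lmul_smul hact hx,
      mulRight_smul, map_add, map_sub, map_smul, map_smul, map_smul, smul_sub]
    abel

theorem biMk_antiRep (b : R ⊗[k] H) :
    antiproduct act b = (data act).biMk (antiRep k R H b) := rfl

theorem biMk_mulRight_antiRep (hact : IsModuleAlgebra (BialgData.of k H) act)
    (hH : Algebra.adjoin k {x : H | IsPrimitive k x} = ⊤) (b : R ⊗[k] H) (r : R) :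
    (data act).biMk ((data act).mulRight ((data act).incl r) (antiRep k R H b)) =
      antiproduct act (r • b) := by
  rw [map_smul, biMk_antiRep]
  induction b with
  | zero => simp
  | add y y' hy hy' => simp only [map_add, smul_add, hy, hy']
  | tmul s h =>
    have : s ⊗ₜ[k] h = s • ((1 : R) ⊗ₜ[k] h) := by
      rw [smul_tmul', smul_eq_mul, _root_.mul_one]
    rw [this, map_smul, mulRight_smul, map_smul, map_smul, antiproduct_comm hact hH, smul_comm]

variable (act) in
/-- The map `x ⊗ y ↦ E(x) y`. -/
def antiMul (hact : IsModuleAlgebra (BialgData.of k H) act)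
    (hH : Algebra.adjoin k {x : H | IsPrimitive k x} = ⊤) :
    (R ⊗[k] H) ⊗[R] (R ⊗[k] H) →+ (data act).BiTensor :=
  liftBalanced (fun x y => (data act).biMk ((data act).mulRight y (antiRep k R H x)))
    (fun _ _ _ => by simp only [map_add])
    (fun _ _ _ => by rw [mulRight_add, map_add])
    -- Balanced because `E(rx) = E(x) r`.
    (fun r x y => by
      rw [(isRkAlgebra hact hH).smul_eq r y, ← mulRight_mulRight hact hH]
      exact biMk_mulRight_congr hact hH y (biMk_mulRight_antiRep hact hH x r).symm)

theorem antiMul_tmul (hact : IsModuleAlgebra (BialgData.of k H) act)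
    (hH : Algebra.adjoin k {x : H | IsPrimitive k x} = ⊤) (x y : R ⊗[k] H) :
    antiMul act hact hH (x ⊗ₜ y) =
      (data act).biMk ((data act).mulRight y (antiRep k R H x)) :=
  liftBalanced_tmul _ _ _ _ _ _

/-- By coassociativity the left side is built from `h₁ ⊗ S(h₂) h₃`, and the antipode and counit laws
reduce this to `h ⊗ 1`. -/
theorem antiMul_comul (hact : IsModuleAlgebra (BialgData.of k H) act)
    (hH : Algebra.adjoin k {x : H | IsPrimitive k x} = ⊤) (b : R ⊗[k] H) :
    antiMul act hact hH ((data act).comul b) = (data act).biMk (b ⊗ₜ[k] (data act).incl 1) := by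
  induction b with
  | zero => simp
  | add y y' hy hy' => simp only [map_add, add_tmul, hy, hy']
  | tmul r h =>
    have h₁ : ∀ (b : H) (w : H ⊗[k] H),
        (data act).mulRight (1 ⊗ₜ b) (inclTensor R H ((HopfAlgebra.antipode k).lTensor H w)) =
        inclTensor R H ((LinearMap.mul' k H ∘ₗ (HopfAlgebra.antipode k).rTensor H).lTensor H
          (TensorProduct.assoc k H H H (w ⊗ₜ b))) := by
      intro b w
      induction w with
      | zero => simp
      | add y y' hy hy' => simp only [map_add, add_tmul, hy, hy']
      | tmul c d =>
        rw [LinearMap.lTensor_tmul, inclTensor_tmul, mulRight_tmul, data_mul_tmul,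
          lmul_one_tmul hact, one_smul]
        rfl
    have h₂ : ∀ z : H ⊗[k] H,
        antiMul act hact hH (AlgebraTensorModule.distribBaseChange k R H H (r ⊗ₜ z)) =
        r • (data act).biMk (inclTensor R H
          ((LinearMap.mul' k H ∘ₗ (HopfAlgebra.antipode k).rTensor H).lTensor H
            (TensorProduct.assoc k H H H (comul.rTensor H z)))) := by
      intro z
      induction z with
      | zero => simp
      | add y y' hy hy' => simp only [map_add, tmul_add, smul_add, hy, hy']
      | tmul a b =>
        rw [AlgebraTensorModule.distribBaseChange_tmul, antiMul_tmul, antiRep_tmul, mulRight_smul,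
          map_smul, h₁, LinearMap.rTensor_tmul]
    rw [data_comul_tmul, h₂, coassoc_apply, ← LinearMap.lTensor_comp_apply, LinearMap.comp_assoc,
      HopfAlgebra.mul_antipode_rTensor_comul, LinearMap.lTensor_comp_apply, lTensor_counit_comul,
      LinearMap.lTensor_tmul, inclTensor_tmul, Algebra.linearMap_apply, map_one, data_incl,
      ← map_smul, smul_tmul', smul_tmul', smul_eq_mul, _root_.mul_one]

variable (act) in
/-- The map `x ⊗ y ↦ Δ(x) ⊗ y`. -/
def comulTensor : (R ⊗[k] H) ⊗[k] (R ⊗[k] H) →+ (R ⊗[k] H) ⊗[R] (data act).BiTensor :=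
  liftBalanced
    (fun x y => ((data act).biMk ∘ₗ (AlgebraTensorModule.mk k R (R ⊗[k] H) (R ⊗[k] H)).flip y).lTensor
      (R ⊗[k] H) ((data act).comul x))
    (fun _ _ _ => by simp only [map_add])
    (fun x y y' => by rw [map_add, LinearMap.comp_add, LinearMap.lTensor_add]; rfl)
    (fun c x y => by
      rw [← algebraMap_smul R c x, map_smul, map_smul]
      rw [← LinearMap.smul_apply, ← LinearMap.lTensor_smul]
      congr 2
      ext b
      simp)

theorem comulTensor_tmul (x y : R ⊗[k] H) : comulTensor act (x ⊗ₜ y) =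
    ((data act).biMk ∘ₗ (AlgebraTensorModule.mk k R (R ⊗[k] H) (R ⊗[k] H)).flip y).lTensor
      (R ⊗[k] H) ((data act).comul x) :=
  liftBalanced_tmul _ _ _ _ _ _

theorem comulTensor_smul (r : R) (z : (R ⊗[k] H) ⊗[k] (R ⊗[k] H)) :
    comulTensor act (r • z) = r • comulTensor act z := by
  induction z with
  | zero => simp
  | add y y' hy hy' => simp only [map_add, smul_add, hy, hy']
  | tmul a b => rw [smul_tmul', comulTensor_tmul, comulTensor_tmul, map_smul, map_smul]

theorem comulTensor_congr (hact : IsModuleAlgebra (BialgData.of k H) act)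
    (hH : Algebra.adjoin k {x : H | IsPrimitive k x} = ⊤)
    {z z' : (R ⊗[k] H) ⊗[k] (R ⊗[k] H)} (h : (data act).biMk z = (data act).biMk z') :
    comulTensor act z = comulTensor act z' := by
  refine map_eq_of_biMk_eq (comulTensor act)
    (fun r z hz => by rw [comulTensor_smul, hz, smul_zero]) (fun b c r => ?_) h
  -- The coefficient `r` is put into the second factor, so that `Δ(br) = ∑ b₁ ⊗ b₂ r` and `r` can
  -- then be moved across the tensor sign of `B ⊗_r B`.
  have h₁ : (data act).comul ((data act).incl r) =
      ∑ _j : Fin 1, (data act).incl 1 ⊗ₜ[R] (data act).incl r := by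
    rw [Fin.sum_univ_one, data_incl, data_incl, data_comul_tmul, Bialgebra.comul_one,
      Algebra.TensorProduct.one_def, AlgebraTensorModule.distribBaseChange_tmul]
    have : r ⊗ₜ[k] (1 : H) = r • ((1 : R) ⊗ₜ[k] (1 : H)) := by
      rw [smul_tmul', smul_eq_mul, _root_.mul_one]
    rw [this, smul_tmul]
  rw [comulTensor_tmul, comulTensor_tmul, comul_mul_eq_sum hact hH b _ _ _ h₁, Fin.sum_univ_one]
  generalize (data act).comul b = w
  induction w with
  | zero => simp
  | add y y' hy hy' => simp only [map_add, hy, hy']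
  | tmul x x' =>
    rw [TensorProduct.map_tmul, LinearMap.lTensor_tmul, LinearMap.lTensor_tmul]
    change (data act).mul x ((data act).incl 1) ⊗ₜ[R]
      (data act).biMk ((data act).mul x' ((data act).incl r) ⊗ₜ[k] c) = x ⊗ₜ[R]
      (data act).biMk (x' ⊗ₜ[k] ((data act).mul ((data act).incl r) c))
    rw [(isRkAlgebra hact hH).mul_one, biMk_balanced]

theorem data_comul_eq_smul (r : R) (h : H) : (data act).comul (r ⊗ₜ h) =
    r • AlgebraTensorModule.distribBaseChange k R H H (1 ⊗ₜ[k] comul h) := by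
  rw [data_comul_tmul, ← distribBaseChange_smul, _root_.mul_one]

theorem comulTensor_inclTensor (h : H) :
    comulTensor act (inclTensor R H ((HopfAlgebra.antipode k).lTensor H (comul h))) =
      (antiproduct act).lTensor (R ⊗[k] H)
        (AlgebraTensorModule.distribBaseChange k R H H (1 ⊗ₜ comul h)) := by
  -- With `Θ(a ⊗ b ⊗ c) = (1 # a) ⊗ ((1 # b) ⊗ (1 # S(c)))`, the two sides are the images under `Θ`
  -- of the two sides of coassociativity in `H`.
  let Θ : H ⊗[k] (H ⊗[k] H) →+ (R ⊗[k] H) ⊗[R] (data act).BiTensor :=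
    liftBalanced (fun a z => ((1 : R) ⊗ₜ[k] a) ⊗ₜ[R] (data act).biMk
        (inclTensor R H ((HopfAlgebra.antipode k).lTensor H z)))
      (fun _ _ _ => by rw [tmul_add, add_tmul])
      (fun _ _ _ => by simp only [map_add, tmul_add])
      (fun c a z => by
        rw [map_smul, map_smul, ← algebraMap_smul R c (inclTensor R H _), map_smul,
          tmul_smul, ← algebraMap_smul R c, smul_tmul])
  have hΘ : ∀ a z, Θ (a ⊗ₜ z) = ((1 : R) ⊗ₜ[k] a) ⊗ₜ[R] (data act).biMk
        (inclTensor R H ((HopfAlgebra.antipode k).lTensor H z)) :=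
    fun a z => liftBalanced_tmul _ _ _ _ _ _
  have h₁ : ∀ z : H ⊗[k] H, (antiproduct act).lTensor (R ⊗[k] H)
      (AlgebraTensorModule.distribBaseChange k R H H (1 ⊗ₜ z)) = Θ (comul.lTensor H z) := by
    intro z
    induction z with
    | zero => simp
    | add y y' hy hy' => simp only [map_add, tmul_add, hy, hy']
    | tmul a b =>
      rw [AlgebraTensorModule.distribBaseChange_tmul, LinearMap.lTensor_tmul,
        LinearMap.lTensor_tmul, hΘ, biMk_antiRep, antiRep_tmul, one_smul]
  have h₂ : ∀ (b : H) (w : H ⊗[k] H),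
      ((data act).biMk ∘ₗ (AlgebraTensorModule.mk k R (R ⊗[k] H) (R ⊗[k] H)).flip
        (1 ⊗ₜ HopfAlgebra.antipode k b)).lTensor (R ⊗[k] H)
          (AlgebraTensorModule.distribBaseChange k R H H (1 ⊗ₜ w)) =
        Θ (TensorProduct.assoc k H H H (w ⊗ₜ b)) := by
    intro b w
    induction w with
    | zero => simp
    | add y y' hy hy' => simp only [map_add, tmul_add, add_tmul, hy, hy']
    | tmul c d =>
      rw [AlgebraTensorModule.distribBaseChange_tmul, LinearMap.lTensor_tmul,
        TensorProduct.assoc_tmul, hΘ, LinearMap.lTensor_tmul, inclTensor_tmul]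
      rfl
  have h₃ : ∀ z : H ⊗[k] H, comulTensor act
      (inclTensor R H ((HopfAlgebra.antipode k).lTensor H z)) =
      Θ (TensorProduct.assoc k H H H (comul.rTensor H z)) := by
    intro z
    induction z with
    | zero => simp
    | add y y' hy hy' => simp only [map_add, hy, hy']
    | tmul a b =>
      rw [LinearMap.lTensor_tmul, inclTensor_tmul, comulTensor_tmul, data_comul_tmul, h₂,
        LinearMap.rTensor_tmul]
  exact (h₃ _).trans ((congrArg Θ (coassoc_apply (R := k) h)).trans (h₁ _).symm)

theorem comulTensor_antiRep (b : R ⊗[k] H) : comulTensor act (antiRep k R H b) =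
    (antiproduct act).lTensor (R ⊗[k] H) ((data act).comul b) := by
  induction b with
  | zero => simp
  | add y y' hy hy' => simp only [map_add, hy, hy']
  | tmul r h =>
    rw [antiRep_tmul, comulTensor_smul, comulTensor_inclTensor, data_comul_eq_smul, map_smul]

/-- The relations `br ⊗ c = b ⊗ rc` are respected by multiplication because it is associative. -/
theorem lift_mul_congr (hact : IsModuleAlgebra (BialgData.of k H) act)
    (hH : Algebra.adjoin k {x : H | IsPrimitive k x} = ⊤)
    {z z' : (R ⊗[k] H) ⊗[k] (R ⊗[k] H)} (h : (data act).biMk z = (data act).biMk z') :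
    TensorProduct.lift (data act).mul z = TensorProduct.lift (data act).mul z' := by
  have hsmul (r : R) (z : (R ⊗[k] H) ⊗[k] (R ⊗[k] H)) :
      TensorProduct.lift (data act).mul (r • z) = r • TensorProduct.lift (data act).mul z := by
    induction z with
    | zero => simp
    | add y y' hy hy' => simp only [map_add, smul_add, hy, hy']
    | tmul a b => exact mul_smul r a b
  refine map_eq_of_biMk_eq (act := act) (P := R ⊗[k] H)
    (TensorProduct.lift (data act).mul : _ →ₗ[k] _).toAddMonoidHom
    (fun r z hz => ?_) (fun b c r => ?_) h
  · exact (hsmul r z).trans ((congrArg (r • ·) hz).trans (smul_zero r))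
  · exact mul_assoc hact hH b _ c

theorem lift_mul_antiRep (hact : IsModuleAlgebra (BialgData.of k H) act) (b : R ⊗[k] H) :
    TensorProduct.lift (data act).mul (antiRep k R H b) =
      (data act).incl ((data act).counit b) := by
  induction b with
  | zero => simp
  | add y y' hy hy' => simp only [map_add, hy, hy']
  | tmul r h =>
    have h₁ : ∀ z : H ⊗[k] H, TensorProduct.lift (data act).mul (r • inclTensor R H z) =
        r ⊗ₜ LinearMap.mul' k H z := by
      intro z
      induction z with
      | zero => simp
      | add y y' hy hy' => simp only [map_add, smul_add, tmul_add, hy, hy']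
      | tmul a b =>
        rw [inclTensor_tmul, smul_tmul', TensorProduct.lift.tmul, mul_smul, data_mul_tmul,
          one_smul, lmul_one_tmul hact, smul_tmul', smul_eq_mul, _root_.mul_one]
        rfl
    rw [antiRep_tmul, h₁, HopfAlgebra.mul_antipode_lTensor_comul_apply, data_counit_tmul,
      data_incl, Algebra.algebraMap_eq_smul_one, tmul_smul, smul_tmul']

/-- The smash product of `R` and a Hopf algebra that is generated by primitive elements is an
`R/k`-Hopf algebra. -/
theorem isRkHopfAlgebra (hact : IsModuleAlgebra (BialgData.of k H) act)
    (hH : Algebra.adjoin k {x : H | IsPrimitive k x} = ⊤) : IsRkHopfAlgebra (data act) where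
  toIsRkBialgebra := isRkBialgebra hact hH
  -- The laws speak of arbitrary representatives. The congruence lemmas replace them by `antiRep`,
  -- for which each law has been computed.
  exists_antiproduct := ⟨antiproduct act,
    { map_smul_right := fun r b z hz =>
        (biMk_mulRight_antiRep hact hH b r).symm.trans (biMk_mulRight_congr hact hH _ hz)
      sum_mul := fun b n x y z hb hz => by
        rw [← antiMul_comul hact hH, hb, map_sum]
        refine Finset.sum_congr rfl fun i _ => ?_
        rw [antiMul_tmul]
        exact biMk_mulRight_congr hact hH _ (hz i).symm
      lTensor_comul := fun b n x y hb => by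
        rw [← comulTensor_antiRep]
        rw [← map_sum] at hb
        rw [comulTensor_congr hact hH hb, map_sum]
        refine Finset.sum_congr rfl fun i _ => ?_
        rw [comulTensor_tmul]
      mul_eq := fun b z hz => by
        rw [← lift_mul_antiRep hact, lift_mul_congr hact hH hz.symm] }⟩

end Hopf

end Smash

/-! ## Module algebras and homomorphisms of smash products -/

section ModuleAlgebra

open TensorProduct

variable {k : Type u} {R : Type v} {H : Type w} [Field k] [CommRing R] [Algebra k R]
  [AddCommGroup H] [Module k H] {H' : Type*} [AddCommGroup H'] [Module k H']

theorem IsModuleAlgebra.comp {A : BialgData k H} {A' : BialgData k H'}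
    {act : H' →ₗ[k] Module.End k R} (hact : IsModuleAlgebra A' act) {φ : H →ₗ[k] H'}
    (hφ : IsBialgHom A A' φ) : IsModuleAlgebra A (act ∘ₗ φ) where
  one_act := by rw [LinearMap.comp_apply, hφ.map_one, hact.one_act]
  mul_act h g := by
    simp only [LinearMap.comp_apply, hφ.map_mul, hact.mul_act]
  act_mul h r s := by
    rw [LinearMap.comp_apply, hact.act_mul, hφ.map_comul]
    generalize A.comul h = z
    induction z with
    | zero => simp
    | add y y' hy hy' => simp only [map_add, LinearMap.add_apply, hy, hy']
    | tmul a b => rfl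
  act_one h := by rw [LinearMap.comp_apply, hact.act_one, hφ.map_counit]

theorem IsBialgHom.baseChange {A : BialgData k H} {A' : BialgData k H'}
    (act : H' →ₗ[k] Module.End k R) {φ : H →ₗ[k] H'} (hφ : IsBialgHom A A' φ) :
    IsRkBialgebraHom (smash A (act ∘ₗ φ)) (smash A' act) (φ.baseChange R) where
  map_mul b c := by
    induction b with
    | zero => simp
    | add y y' hy hy' => simp only [map_add, LinearMap.add_apply, hy, hy']
    | tmul r h =>
    induction c with
    | zero => simp
    | add y y' hy hy' => simp only [map_add, hy, hy']
    | tmul s g =>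
      change φ.baseChange R (r • TensorProduct.map₂ (act ∘ₗ φ) A.mul (A.comul h) (s ⊗ₜ g)) =
        r • TensorProduct.map₂ act A'.mul (A'.comul (φ h)) (s ⊗ₜ φ g)
      rw [map_smul, hφ.map_comul]
      generalize A.comul h = z
      congr 1
      induction z with
      | zero => simp
      | add y y' hy hy' => simp only [map_add, LinearMap.add_apply, hy, hy']
      | tmul a b => simp [hφ.map_mul]
  map_incl r := by
    change r ⊗ₜ φ A.one = r ⊗ₜ A'.one
    rw [hφ.map_one]
  map_comul b := by
    induction b with
    | zero => simp
    | add y y' hy hy' => simp only [map_add, hy, hy']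
    | tmul r h =>
      change AlgebraTensorModule.distribBaseChange k R H' H' (r ⊗ₜ A'.comul (φ h)) =
        TensorProduct.map (φ.baseChange R) (φ.baseChange R)
          (AlgebraTensorModule.distribBaseChange k R H H (r ⊗ₜ A.comul h))
      rw [hφ.map_comul]
      generalize A.comul h = z
      induction z with
      | zero => simp
      | add y y' hy hy' => simp only [map_add, tmul_add, hy, hy']
      | tmul a b => rfl
  map_counit b := by
    induction b with
    | zero => simp
    | add y y' hy hy' => simp only [map_add, hy, hy']
    | tmul r h =>
      change A'.counit (φ h) • r = A.counit h • r
      rw [hφ.map_counit]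

/-- The multiplication of the smash product is the law `h·(uv) = ∑ (h₁·u)(h₂·v)` with `u = s` and `v
= g·t`. -/
theorem smashToEnd_mul {A : BialgData k H} {act : H →ₗ[k] Module.End k R}
    (hact : IsModuleAlgebra A act) (b c : R ⊗[k] H) :
    smashToEnd act ((smash A act).mul b c) = smashToEnd act b * smashToEnd act c := by
  induction b with
  | zero => simp
  | add y y' hy hy' => simp only [map_add, LinearMap.add_apply, add_mul, hy, hy']
  | tmul r h =>
  induction c with
  | zero => simp
  | add y y' hy hy' => simp only [map_add, mul_add, hy, hy']
  | tmul s g =>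
    ext t
    have h₀ : ∀ r : R, ∀ y : R ⊗[k] H, smashToEnd act (r • y) = r • smashToEnd act y := by
      intro r y
      induction y with
      | zero => simp
      | add y y' hy hy' => simp only [map_add, smul_add, hy, hy']
      | tmul a b => exact mul_smul r a (act b)
    have h₁ : ∀ z : H ⊗[k] H, smashToEnd act (TensorProduct.map₂ act A.mul z (s ⊗ₜ g)) t =
        LinearMap.mul' k R (TensorProduct.map₂ act act z (s ⊗ₜ act g t)) := by
      intro z
      induction z with
      | zero => simp
      | add y y' hy hy' => simp only [map_add, LinearMap.add_apply, hy, hy']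
      | tmul a b =>
        simp only [map₂_apply_tmul, TensorProduct.map_tmul, LinearMap.mul'_apply]
        change act a s * act (A.mul b g) t = _
        rw [hact.mul_act]; rfl
    change smashToEnd act (r • TensorProduct.map₂ act A.mul (A.comul h) (s ⊗ₜ g)) t =
      r * act h (s * act g t)
    rw [h₀, LinearMap.smul_apply, h₁, hact.act_mul, smul_eq_mul]

end ModuleAlgebra

/-! ## The Hopf algebra of higher order derivations -/

section Diff

attribute [local instance 100] LieRing.ofAssociativeRing

open TensorProduct

variable {k : Type u} {R : Type v} [Field k] [CommRing R] [Algebra k R] (S : Set (Der k R))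

theorem uCounit_iota (E : Der k R) : uCounit k R (iota E) = 0 :=
  UniversalEnvelopingAlgebra.lift_ι_apply k (0 : Der k R →ₗ⁅k⁆ k) E

variable {S} in
/-- The generator of `Diff_k(S)` given by an element of `S`. -/
def diffGen {E : Der k R} (hE : E ∈ S) : Diff S := ⟨iota E, iota_mem_Diff hE⟩

variable {S} in
theorem diffComul_gen {E : Der k R} (hE : E ∈ S) :
    diffComul S (diffGen hE) = diffGen hE ⊗ₜ[k] 1 + 1 ⊗ₜ[k] diffGen hE := by
  refine diffInclTensor_injective S ?_
  rw [diffInclTensor_diffComul]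
  refine (uComul_iota k R E).trans ?_
  simp [diffInclTensor, diffGen]

/-- The counit of `Diff_k(S)`. -/
def diffCounit : Diff S →ₐ[k] k := (uCounit k R).comp (Diff S).val

variable {S} in
theorem diffCounit_gen {E : Der k R} (hE : E ∈ S) : diffCounit S (diffGen hE) = 0 :=
  uCounit_iota E

variable {S} in
theorem diff_algHom_ext {A : Type*} [Semiring A] [Algebra k A] {f g : Diff S →ₐ[k] A}
    (h : ∀ (E : Der k R) (hE : E ∈ S), f (diffGen hE) = g (diffGen hE)) : f = g := by
  refine AlgHom.adjoin_ext ?_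
  rintro _ ⟨E, hE, rfl⟩
  exact h E hE

/-- All the maps involved are algebra homomorphisms, so the coalgebra laws need checking only on the
primitive generators. -/
instance : Bialgebra k (Diff S) :=
  Bialgebra.ofAlgHom (diffComul S) (diffCounit S)
    (diff_algHom_ext fun E hE => by
      simp only [AlgHom.comp_apply, diffComul_gen, map_add, Algebra.TensorProduct.map_tmul,
        map_one, AlgHom.id_apply, add_tmul, tmul_add, Algebra.TensorProduct.one_def]
      simp [add_assoc])
    (diff_algHom_ext fun E hE => by
      simp [diffComul_gen, diffCounit_gen])
    (diff_algHom_ext fun E hE => by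
      simp [diffComul_gen, diffCounit_gen])

/-- The generators of `Diff_k(S)`. -/
def diffGens : Set (Diff S) := Subtype.val ⁻¹' (iota '' S)

theorem adjoin_diffGens : Algebra.adjoin k (diffGens S) = ⊤ :=
  Algebra.adjoin_adjoin_coe_preimage

variable {S} in
theorem exists_of_mem_diffGens {x : Diff S} (hx : x ∈ diffGens S) :
    ∃ (E : Der k R) (hE : E ∈ S), x = diffGen hE := by
  obtain ⟨E, hE, h⟩ := hx
  exact ⟨E, hE, Subtype.ext h.symm⟩

variable {S} in
theorem isPrimitive_of_mem_diffGens {x : Diff S} (hx : x ∈ diffGens S) : IsPrimitive k x := by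
  obtain ⟨E, hE, rfl⟩ := exists_of_mem_diffGens hx
  exact diffComul_gen hE

theorem adjoin_isPrimitive_diff : Algebra.adjoin k {x : Diff S | IsPrimitive k x} = ⊤ :=
  top_le_iff.1 ((adjoin_diffGens S).ge.trans
    (Algebra.adjoin_mono fun _ hx => isPrimitive_of_mem_diffGens hx))

variable (k R) in
/-- The antipode of `U(Der(R))`. -/
def uAntipode : UDer k R →ₐ[k] (UDer k R)ᵐᵒᵖ :=
  UniversalEnvelopingAlgebra.lift k
    { toFun := fun E => MulOpposite.op (-iota E)
      map_add' := fun E F => by rw [map_add, neg_add, MulOpposite.op_add]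
      map_smul' := fun c E => by rw [map_smul, ← smul_neg, MulOpposite.op_smul]; rfl
      -- Passing to the opposite algebra reverses the sign of a commutator. The sign in `-iota E`
      -- compensates for this.
      map_lie' := fun {E F} => by
        have h : iota (k := k) ⁅E, F⁆ = iota E * iota F - iota F * iota E :=
          (UniversalEnvelopingAlgebra.ι k : Der k R →ₗ⁅k⁆ UDer k R).map_lie E F
        simp only [h, LieRing.of_associative_ring_bracket, ← MulOpposite.op_mul,
          ← MulOpposite.op_sub, neg_mul_neg, neg_sub] }

theorem uAntipode_iota (E : Der k R) : uAntipode k R (iota E) = MulOpposite.op (-iota E) :=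
  UniversalEnvelopingAlgebra.lift_ι_apply k _ E

variable {S} in
theorem uAntipode_mem {x : UDer k R} (hx : x ∈ Diff S) : (uAntipode k R x).unop ∈ Diff S := by
  induction hx using Algebra.adjoin_induction with
  | mem x hx =>
    obtain ⟨E, hE, rfl⟩ := hx
    rw [uAntipode_iota]
    exact neg_mem (iota_mem_Diff hE)
  | algebraMap c => rw [AlgHom.commutes]; exact Subalgebra.algebraMap_mem _ c
  | add x y _ _ hx hy => rw [map_add]; exact add_mem hx hy
  | mul x y _ _ hx hy => rw [map_mul]; exact mul_mem hy hx

/-- The antipode of `Diff_k(S)`. -/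
def diffAntipode : Diff S →ₗ[k] Diff S where
  toFun x := ⟨(uAntipode k R x).unop, uAntipode_mem x.2⟩
  map_add' x y := Subtype.ext (by simp)
  map_smul' c x := Subtype.ext (by simp)

instance : HopfAlgebra k (Diff S) :=
  hopfAlgebraOfPrimitive (fun _ hx => isPrimitive_of_mem_diffGens hx) (adjoin_diffGens S)
    (diffAntipode S) (Subtype.ext (by simp [diffAntipode])) fun x hx h => Subtype.ext (by
      obtain ⟨E, hE, rfl⟩ := exists_of_mem_diffGens hx
      simp [diffAntipode, diffGen, uAntipode_iota])

theorem diffAct_one : diffAct S 1 = 1 :=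
  map_one ((uAct k R).comp (Diff S).val)

theorem diffAct_mul (h g : Diff S) : diffAct S (h * g) = diffAct S h * diffAct S g :=
  map_mul ((uAct k R).comp (Diff S).val) h g

variable {S} in
theorem diffAct_gen {E : Der k R} (hE : E ∈ S) (r : R) : diffAct S (diffGen hE) r = E r :=
  uAct_iota k R E r

variable {S} in
theorem diffAct_leibniz {E : Der k R} (hE : E ∈ S) (z : Diff S ⊗[k] Diff S) (r s : R) :
    E (LinearMap.mul' k R (TensorProduct.map₂ (diffAct S) (diffAct S) z (r ⊗ₜ[k] s))) =
      LinearMap.mul' k R (TensorProduct.map₂ (diffAct S) (diffAct S)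
        ((diffGen hE ⊗ₜ[k] 1 + 1 ⊗ₜ[k] diffGen hE) * z) (r ⊗ₜ[k] s)) := by
  induction z with
  | zero => simp
  | add y y' hy hy' => simp only [map_add, LinearMap.add_apply, mul_add, hy, hy']
  | tmul a b =>
    simp only [add_mul, Algebra.TensorProduct.tmul_mul_tmul, one_mul, map_add,
      LinearMap.add_apply, TensorProduct.map₂_apply_tmul, TensorProduct.map_tmul,
      LinearMap.mul'_apply, diffAct_mul, Module.End.mul_apply, diffAct_gen, Derivation.leibniz,
      smul_eq_mul]
    ring

theorem diffAct_apply_mul (h : Diff S) (r s : R) :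
    diffAct S h (r * s) = LinearMap.mul' k R
      (TensorProduct.map₂ (diffAct S) (diffAct S) (Coalgebra.comul (R := k) h) (r ⊗ₜ[k] s)) := by
  induction h using adjoin_left_induction (adjoin_diffGens S) with
  | hadd x y hx hy => simp only [map_add, LinearMap.add_apply, hx, hy]
  | hsmul c x hx => simp only [map_smul, LinearMap.smul_apply, hx]
  | hone => simp [Algebra.TensorProduct.one_def, diffAct_one]
  | hmul x h hx hh =>
    obtain ⟨E, hE, rfl⟩ := exists_of_mem_diffGens hx
    rw [Bialgebra.comul_mul, isPrimitive_of_mem_diffGens hx, diffAct_mul, Module.End.mul_apply,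
      hh, diffAct_gen, diffAct_leibniz hE]

theorem diffAct_apply_one (h : Diff S) :
    diffAct S h 1 = algebraMap k R (Coalgebra.counit (R := k) h) := by
  induction h using adjoin_left_induction (adjoin_diffGens S) with
  | hadd x y hx hy => simp only [map_add, LinearMap.add_apply, hx, hy]
  | hsmul c x hx =>
    simp only [map_smul, LinearMap.smul_apply, hx, Algebra.algebraMap_eq_smul_one, smul_assoc]
  | hone => simp [diffAct_one]
  | hmul x h hx hh =>
    obtain ⟨E, hE, rfl⟩ := exists_of_mem_diffGens hx
    rw [Bialgebra.counit_mul, (isPrimitive_of_mem_diffGens hx).counit_eq_zero, diffAct_mul,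
      Module.End.mul_apply, hh, diffAct_gen, zero_mul, map_zero, Derivation.map_algebraMap]

theorem isModuleAlgebra_diffAct : IsModuleAlgebra (diffData S) (diffAct S) where
  one_act := diffAct_one S
  mul_act := diffAct_mul S
  act_mul := diffAct_apply_mul S
  act_one := diffAct_apply_one S

/-! ### The images in the algebra of endomorphisms -/

theorem range_diffAct : LinearMap.range (diffAct S) = Subalgebra.toSubmodule (Algebra.adjoin k
    ((fun E : Der k R => (E : R →ₗ[k] R)) '' S : Set (Module.End k R))) := by
  have h : ((fun E : Der k R => (E : R →ₗ[k] R)) '' S : Set (Module.End k R)) =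
      uAct k R '' (iota '' S) := by
    rw [Set.image_image]
    refine Set.image_congr fun E _ => ?_
    ext r
    exact (uAct_iota k R E r).symm
  rw [h, ← AlgHom.map_adjoin]
  ext f
  constructor
  · rintro ⟨x, rfl⟩
    exact ⟨x, x.2, rfl⟩
  · rintro ⟨x, hx, rfl⟩
    exact ⟨⟨x, hx⟩, rfl⟩

theorem range_smashToEnd_comp : LinearMap.range
    (smashToEnd (diffAct S) ∘ₗ TensorProduct.mk k R (Diff S) 1) =
      Subalgebra.toSubmodule (Algebra.adjoin k
        ((fun E : Der k R => (E : R →ₗ[k] R)) '' S : Set (Module.End k R))) := by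
  rw [← range_diffAct]
  congr 1
  ext h
  simp [smashToEnd]

theorem smashToEnd_incl (r : R) : smashToEnd (diffAct S) ((smash (diffData S) (diffAct S)).incl r) =
    LinearMap.mulLeft k r := by
  change r • diffAct S 1 = _
  rw [show diffAct S 1 = 1 from map_one ((uAct k R).comp (Diff S).val)]
  ext; simp

theorem range_smashToEnd : LinearMap.range (smashToEnd (diffAct S)) =
    Subalgebra.toSubmodule (Algebra.adjoin k (Set.range (LinearMap.mulLeft k (A := R)) ∪
      (fun E : Der k R => (E : R →ₗ[k] R)) '' S)) := by
  apply le_antisymm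
  · rintro _ ⟨x, rfl⟩
    induction x with
    | zero => rw [map_zero]; exact zero_mem _
    | add x y hx hy => rw [map_add]; exact add_mem hx hy
    | tmul r h =>
      change r • diffAct S h ∈ _
      have h₁ : r • diffAct S h = LinearMap.mulLeft k r * diffAct S h := rfl
      rw [h₁]
      refine mul_mem (S := Subalgebra k (Module.End k R))
        (Algebra.subset_adjoin (Or.inl ⟨r, rfl⟩)) ?_
      have h₂ : diffAct S h ∈ LinearMap.range (diffAct S) := ⟨h, rfl⟩
      rw [range_diffAct] at h₂
      exact Algebra.adjoin_mono Set.subset_union_right h₂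
  -- The image is closed under products by `smashToEnd_mul`, so it is a subalgebra and has only to
  -- contain the generators.
  · let T : Subalgebra k (Module.End k R) :=
      { carrier := LinearMap.range (smashToEnd (diffAct S))
        mul_mem' := by
          rintro _ _ ⟨x, rfl⟩ ⟨y, rfl⟩
          exact ⟨_, smashToEnd_mul (isModuleAlgebra_diffAct S) x y⟩
        add_mem' := fun hx hy => add_mem hx hy
        algebraMap_mem' := fun c => by
          refine ⟨(smash (diffData S) (diffAct S)).incl (algebraMap k R c), ?_⟩
          rw [smashToEnd_incl]
          ext; simp [Algebra.smul_def] }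
    refine (Algebra.adjoin_le (S := T) ?_ : _ ≤ T)
    rintro _ (⟨r, rfl⟩ | ⟨E, hE, rfl⟩)
    · exact ⟨_, smashToEnd_incl S r⟩
    · refine ⟨1 ⊗ₜ diffGen hE, ?_⟩
      change (1 : R) • diffAct S (diffGen hE) = _
      rw [one_smul]
      ext r
      exact uAct_iota k R E r

end Diff

/-! ## Bialgebra homomorphisms from the algebra of trees -/

namespace OTree

variable {α : Type*} {M : Type*} [AddCommMonoid M]

theorem sumGraft_planted (a : α) (C T : OTree α) (f : OTree α → M) :
    sumGraft (cons a C one) T f = f (cons a C T) + sumInner T (cons a C one) f := by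
  rw [sumGraft_eq, sumSplits_cons, sumSplits_one, sumInner_right_one]; rfl

theorem sumInner_cons_planted (a : α) (C : OTree α) (b : α) (D T : OTree α) (f : OTree α → M) :
    sumInner (cons b D T) (cons a C one) f =
      sumGraft (cons a C one) D (fun D' => f (cons b D' T)) +
        sumInner T (cons a C one) fun T' => f (cons b D T') := by
  simp only [sumInner_cons, sumSplits_cons, sumSplits_one, sumInner_right_one, sumGraft_one_left]

/-- The product of the values of `g` at the labels of the children of the root, if all these
children are leaves, and `0` otherwise. -/
def leafProd {A : Type*} [Ring A] (g : α → A) : OTree α → A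
  | one => 1
  | cons a one T => g a * leafProd g T
  | cons _ (cons _ _ _) _ => 0

variable {A : Type*} [Ring A] (g : α → A)

/-- Every `D'` contains the newly linked node, so the child `b` is not a leaf and each summand is
zero. -/
theorem sumGraft_planted_leafProd (a : α) (C : OTree α) (b : α) (D T : OTree α) :
    sumGraft (cons a C one) D (fun D' => leafProd g (cons b D' T)) = 0 := by
  rw [sumGraft_planted]
  cases D with
  | one => rw [sumInner_one_cons, leafProd, add_zero]
  | cons d D₁ D₂ =>
    simp only [sumInner_cons_planted, leafProd, sumInner_zero, add_zero]
    exact (zero_add _).trans (listSum_zero (M := A) _)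

/-- Linking off the root always creates a node at depth at least two. Thus `leafProd` does not see
the correction term in `planted_mul`, and becomes multiplicative. -/
theorem sumInner_planted_leafProd (a : α) (C T : OTree α) :
    sumInner T (cons a C one) (leafProd g) = 0 := by
  induction T with
  | one => exact sumInner_one_cons _ _ _ _
  | cons b D T _ ih =>
    rw [sumInner_cons_planted, sumGraft_planted_leafProd, zero_add]
    cases D with
    | one =>
      simp only [leafProd]
      rw [← mul_zero (g b), ← ih]
      exact (map_listSum (AddMonoidHom.mulLeft (g b)) _ _).symm
    | cons d D₁ D₂ =>
      simp only [leafProd, sumInner_zero]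

end OTree

namespace TreeAlgebra

open OTree TensorProduct

variable {k : Type u} [Field k] {α : Type v}

section

variable {A : Type*} [Ring A]

/-- Left factors from a generating set suffice: the remaining cases follow by moving brackets. -/
theorem map_mul_of_planted [Algebra k A] {f : TreeAlgebra k α →ₗ[k] A} (hone : f 1 = 1)
    (hmul : ∀ a C T, f (ofTree (cons a C one) * ofTree T) =
      f (ofTree (cons a C one)) * f (ofTree T)) (x y : TreeAlgebra k α) :
    f (x * y) = f x * f y := by
  have hmul' : ∀ a C y, f (ofTree (cons a C one) * y) = f (ofTree (cons a C one)) * f y := by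
    intro a C y
    induction y using induction with
    | hadd x y hx hy => simp only [mul_add, map_add, hx, hy]
    | hsmul c x hx => simp only [mul_smul_comm, map_smul, hx]
    | htree T => exact hmul a C T
  induction x using planted_induction with
  | hadd x x' hx hx' => simp only [add_mul, map_add, hx, hx']
  | hsmul c x hx => simp only [smul_mul_assoc, map_smul, hx]
  | hone => rw [one_mul, hone, one_mul]
  | hmul a C x hx => rw [mul_assoc, hmul', hmul', hx, mul_assoc]

variable [Bialgebra k A]

theorem map_comul_of_planted {f : TreeAlgebra k α →ₗ[k] A} (hone : f 1 = 1)
    (hmul : ∀ x y, f (x * y) = f x * f y)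
    (hprim : ∀ a C, IsPrimitive k (f (ofTree (cons a C one)))) (x : TreeAlgebra k α) :
    Coalgebra.comul (R := k) (f x) = TensorProduct.map f f (Coalgebra.comul (R := k) x) := by
  induction x using planted_induction with
  | hadd x x' hx hx' => simp only [map_add, hx, hx']
  | hsmul c x hx => simp only [map_smul, hx]
  | hone =>
    rw [hone, Bialgebra.comul_one, Bialgebra.comul_one, Algebra.TensorProduct.one_def,
      Algebra.TensorProduct.one_def, TensorProduct.map_tmul, hone]
  | hmul a C x hx =>
    rw [hmul, Bialgebra.comul_mul, Bialgebra.comul_mul, hprim, isPrimitive_planted, hx]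
    generalize (Coalgebra.comul x : TreeAlgebra k α ⊗[k] TreeAlgebra k α) = z
    induction z with
    | zero => simp only [map_zero, mul_zero]
    | add y y' hy hy' => simp only [map_add, mul_add, hy, hy']
    | tmul y z =>
      simp only [add_mul, Algebra.TensorProduct.tmul_mul_tmul, TensorProduct.map_tmul, map_add,
        hmul, one_mul]

theorem map_counit_of_planted {f : TreeAlgebra k α →ₗ[k] A} (hone : f 1 = 1)
    (hmul : ∀ x y, f (x * y) = f x * f y)
    (hprim : ∀ a C, IsPrimitive k (f (ofTree (cons a C one)))) (x : TreeAlgebra k α) :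
    Coalgebra.counit (R := k) (f x) = Coalgebra.counit (R := k) x := by
  induction x using planted_induction with
  | hadd x x' hx hx' => simp only [map_add, hx, hx']
  | hsmul c x hx => simp only [map_smul, hx]
  | hone => rw [hone, Bialgebra.counit_one, Bialgebra.counit_one]
  | hmul a C x hx =>
    rw [hmul, Bialgebra.counit_mul, Bialgebra.counit_mul, (hprim a C).counit_eq_zero,
      (isPrimitive_planted a C).counit_eq_zero, zero_mul, zero_mul]

/-- A linear map that is multiplicative for left multiplication by trees whose root has one child,
and maps these trees to primitive elements, is a homomorphism of bialgebras. -/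
theorem isBialgHom_of_planted {f : TreeAlgebra k α →ₗ[k] A} (hone : f 1 = 1)
    (hmul : ∀ a C T, f (ofTree (cons a C one) * ofTree T) =
      f (ofTree (cons a C one)) * f (ofTree T))
    (hprim : ∀ a C, IsPrimitive k (f (ofTree (cons a C one)))) :
    IsBialgHom (BialgData.of k (TreeAlgebra k α)) (BialgData.of k A) f where
  map_mul := map_mul_of_planted hone hmul
  map_one := hone
  map_comul := map_comul_of_planted hone (map_mul_of_planted hone hmul) hprim
  map_counit := map_counit_of_planted hone (map_mul_of_planted hone hmul) hprim

/-- The linear map that extends `leafProd g`. -/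
def leafHom (g : α → A) : TreeAlgebra k α →ₗ[k] A :=
  (Finsupp.linearCombination k (leafProd g) : KLT k α →ₗ[k] A)

theorem leafHom_ofTree (g : α → A) (T : OTree α) :
    leafHom g (ofTree T : TreeAlgebra k α) = leafProd g T :=
  (Finsupp.linearCombination_single k (1 : k) T).trans (one_smul _ _)

theorem isBialgHom_leafHom {g : α → A} (hg : ∀ a, IsPrimitive k (g a)) :
    IsBialgHom (BialgData.of k (TreeAlgebra k α)) (BialgData.of k A) (leafHom g) := by
  refine isBialgHom_of_planted (leafHom_ofTree g one) (fun a C T => ?_) fun a C => ?_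
  · rw [planted_mul, map_add, sumInner, map_listSum]
    simp only [leafHom_ofTree]
    change _ + sumInner T (cons a C one) (leafProd g) = _
    rw [sumInner_planted_leafProd, add_zero]
    cases C with
    | one => simp only [leafProd, mul_one]
    | cons => simp only [leafProd, zero_mul]
  · rw [leafHom_ofTree]
    cases C with
    | one => simpa only [leafProd, mul_one] using hg a
    | cons =>
      simp only [leafProd, IsPrimitive, map_zero, zero_tmul, tmul_zero, add_zero]

end

end TreeAlgebra

/-! ## The homomorphism given by a connection -/

section ReplaceSum

variable {D M : Type*} [AddCommGroup M]

/-- The sum of the values of `f` at the lists obtained by applying `h` to one entry. -/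
def replaceSum (h : D → D) (f : List D → M) : List D → M
  | [] => 0
  | y :: L => f (h y :: L) + replaceSum h (fun L' => f (y :: L')) L

/-- Translates the sums over `Fin n` in the definitions of `covDer` and `covOp` into a recursion on
lists, which matches the recursion on trees. -/
theorem sum_update_get (h : D → D) (G : (n : ℕ) → (Fin n → D) → M) (L : List D) :
    ∑ l : Fin L.length, G L.length (Function.update L.get l (h (L.get l))) =
      replaceSum h (fun L' => G L'.length L'.get) L := by
  induction L generalizing G with
  | nil => rfl
  | cons y L ih =>
    have hcons : ∀ L' : List D, (Fin.cons y L'.get : Fin (L'.length + 1) → D) = (y :: L').get := by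
      intro L'
      funext i
      cases i using Fin.cases <;> rfl
    have hzero : Function.update (y :: L).get 0 (h y) = (h y :: L).get := by
      funext i
      cases i using Fin.cases <;> rfl
    have hsucc : ∀ l : Fin L.length, Function.update (y :: L).get l.succ (h (L.get l)) =
        (Fin.cons y (Function.update L.get l (h (L.get l))) : Fin (L.length + 1) → D) := by
      intro l
      rw [Fin.cons_update, hcons]
    refine (Fin.sum_univ_succ (n := L.length) _).trans ?_
    refine congrArg₂ (· + ·) (congrArg (G (L.length + 1)) hzero) ?_
    refine (Finset.sum_congr rfl fun l _ => congrArg (G (L.length + 1)) (hsucc l)).trans ?_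
    -- The head `y` is absorbed into `G`, which is why `G` is a family over all arities.
    refine (ih fun n F => G (n + 1) (Fin.cons y F)).trans ?_
    simp only [hcons]; rfl

theorem replaceSum_congr {h : D → D} {f g : List D → M} {L : List D}
    (H : ∀ L', L'.length = L.length → f L' = g L') : replaceSum h f L = replaceSum h g L := by
  induction L generalizing f g with
  | nil => rfl
  | cons y L ih =>
    simp only [replaceSum]
    rw [H (h y :: L) rfl, ih fun L' hL' => H (y :: L') (congrArg (· + 1) hL')]

theorem replaceSum_add (h : D → D) (f g : List D → M) (L : List D) :
    replaceSum h (fun L' => f L' + g L') L = replaceSum h f L + replaceSum h g L := by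
  induction L generalizing f g with
  | nil => exact (add_zero _).symm
  | cons y L ih => simp only [replaceSum, ih]; abel

variable [AddCommGroup D]

/-- A function on lists is additive in every entry, for lists of length `n`. -/
def MultiAdditiveAt (n : ℕ) (f : List D → M) : Prop :=
  ∀ L₁ y z L₂, L₁.length + (L₂.length + 1) = n →
    f (L₁ ++ (y + z) :: L₂) = f (L₁ ++ y :: L₂) + f (L₁ ++ z :: L₂)

theorem MultiAdditiveAt.cons {n : ℕ} {f : List D → M} (hf : MultiAdditiveAt (n + 1) f) (x : D) :
    MultiAdditiveAt n fun L => f (x :: L) := fun L₁ y z L₂ h =>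
  hf (x :: L₁) y z L₂ (by simp only [List.length_cons]; omega)

theorem MultiAdditiveAt.replaceSum_add_left {f : List D → M} {L : List D}
    (hf : MultiAdditiveAt L.length f) (h h' : D → D) :
    replaceSum (fun y => h y + h' y) f L = replaceSum h f L + replaceSum h' f L := by
  induction L generalizing f with
  | nil => exact (add_zero _).symm
  | cons y L ih =>
    simp only [replaceSum]
    rw [ih (hf.cons y), show f ((h y + h' y) :: L) = f (h y :: L) + f (h' y :: L) from
      hf [] (h y) (h' y) L (by simp)]
    abel

theorem MultiAdditiveAt.replaceSum {n : ℕ} {f : List D → M} (hf : MultiAdditiveAt n f)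
    {h : D → D} (hh : ∀ x y, h (x + y) = h x + h y) : MultiAdditiveAt n (replaceSum h f) := by
  intro L₁ y z L₂ hn
  induction L₁ generalizing n f with
  | nil =>
    have hn' : L₂.length + 1 = n := by simpa using hn
    have h₁ : ∀ L, L.length = L₂.length → f ((y + z) :: L) = f (y :: L) + f (z :: L) :=
      fun L hL => hf [] y z L (by simpa [hL] using hn')
    simp only [List.nil_append, TreeHopf.replaceSum]
    rw [replaceSum_congr h₁, replaceSum_add, hh,
      show f ((h y + h z) :: L₂) = f (h y :: L₂) + f (h z :: L₂) from hf [] _ _ L₂ hn]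
    abel
  | cons x L₁ ih =>
    obtain ⟨n, rfl⟩ : ∃ m, n = m + 1 := ⟨L₁.length + (L₂.length + 1), by
      simp only [List.length_cons] at hn; omega⟩
    have hn' : L₁.length + (L₂.length + 1) = n := by
      simp only [List.length_cons] at hn; omega
    simp only [List.cons_append, TreeHopf.replaceSum]
    rw [ih (hf.cons x) hn', show f (h x :: (L₁ ++ (y + z) :: L₂)) =
      f (h x :: (L₁ ++ y :: L₂)) + f (h x :: (L₁ ++ z :: L₂)) from hf (h x :: L₁) y z L₂ hn]
    abel

/-- Multiadditivity for the recursion that defines iterated covariant derivatives. -/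
theorem multiAdditive_of_recursion {f : List D → M} {p : D → M → M} {nab : D → D → D}
    (hp : ∀ x y m, p (x + y) m = p x m + p y m) (hp' : ∀ x m m', p x (m + m') = p x m + p x m')
    (hn : ∀ x y z, nab (x + y) z = nab x z + nab y z)
    (hn' : ∀ x y z, nab x (y + z) = nab x y + nab x z)
    (hf : ∀ x L, f (x :: L) = p x (f L) - replaceSum (nab x) f L) (n : ℕ) :
    MultiAdditiveAt n f := by
  -- The recursion expresses `f` on lists of length `n + 1` through its values on lists of length
  -- `n`, hence additivity at one length at a time. The first entry uses additivity of `p` and `nab`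
  -- in the first variable; the other entries use the induction hypothesis.
  induction n with
  | zero => intro L₁ y z L₂ h; omega
  | succ n ih =>
    intro L₁ y z L₂ h
    cases L₁ with
    | nil =>
      have hL : L₂.length = n := by simpa using h
      subst hL
      simp only [List.nil_append, hf]
      rw [hp, show nab (y + z) = fun t => nab y t + nab z t from funext (hn y z),
        ih.replaceSum_add_left]
      abel
    | cons x L₁ =>
      have hL : L₁.length + (L₂.length + 1) = n := by
        simp only [List.length_cons] at h; omega
      simp only [List.cons_append, hf]
      rw [ih L₁ y z L₂ hL, ih.replaceSum (hn' x) L₁ y z L₂ hL, hp']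
      abel

end ReplaceSum

namespace Connection

open OTree TensorProduct

variable {k : Type u} {R : Type v} [Field k] [CommRing R] [Algebra k R] (N : Connection k R)

/-- `covDer` for lists of derivations. -/
def covDerList (E : Der k R) (L : List (Der k R)) : Der k R := N.covDer E L.length L.get

/-- `covOp` for lists of derivations. -/
def covOpList (L : List (Der k R)) : UDer k R := N.covOp L.length L.get

theorem covDerList_cons (E x : Der k R) (L : List (Der k R)) : N.covDerList E (x :: L) =
    N.nabla x (N.covDerList E L) - replaceSum (N.nabla x) (N.covDerList E) L :=
  congrArg (N.nabla x (N.covDerList E L) - ·) (sum_update_get (N.nabla x) (N.covDer E) L)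

theorem covOpList_cons (x : Der k R) (L : List (Der k R)) : N.covOpList (x :: L) =
    iota x * N.covOpList L - replaceSum (N.nabla x) N.covOpList L :=
  congrArg (iota x * N.covOpList L - ·) (sum_update_get (N.nabla x) N.covOp L)

theorem multiAdditive_covDerList (E : Der k R) (n : ℕ) : MultiAdditiveAt n (N.covDerList E) :=
  multiAdditive_of_recursion N.add_left N.add_right N.add_left N.add_right
    (N.covDerList_cons E) n

theorem multiAdditive_covOpList (n : ℕ) : MultiAdditiveAt n N.covOpList :=
  multiAdditive_of_recursion (p := fun x m => iota x * m)
    (fun x y m => by rw [map_add, add_mul]) (fun x m m' => mul_add _ _ _) N.add_left N.add_right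
    N.covOpList_cons n

section

variable {α : Type*} (label : α → Der k R)

theorem branchDers_cons (a : α) (C T : OTree α) : N.branchDers label (cons a C T) =
    N.covDerList (label a) (N.branchDers label C) :: N.branchDers label T := rfl

/-- Let `X` be the derivation of the planted tree. Linking it to the node `b` itself gives `∇ⁿ⁺¹`
with `X` as first argument; linking it deeper into `D` gives, by `hD`, the sum over replacements by
`∇_X`. The defining recursion says that together these are `∇_X` of the derivation of the branch at
`b`. Additivity of `f` in its first entry takes the sum over trees out of `f`. -/
theorem sumInner_cons_planted_branchDers {M : Type*} [AddCommGroup M] (a : α) (C : OTree α)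
    (b : α) (D T : OTree α) {f : List (Der k R) → M} (hf : ∀ n, MultiAdditiveAt n f)
    (hD : sumInner D (cons a C one) (fun D' => N.covDerList (label b) (N.branchDers label D')) =
      replaceSum (N.nabla (N.covDerList (label a) (N.branchDers label C)))
        (N.covDerList (label b)) (N.branchDers label D))
    (hT : sumInner T (cons a C one)
      (fun T' => f (N.covDerList (label b) (N.branchDers label D) :: N.branchDers label T')) =
        replaceSum (N.nabla (N.covDerList (label a) (N.branchDers label C)))
          (fun L => f (N.covDerList (label b) (N.branchDers label D) :: L))
          (N.branchDers label T)) :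
    sumInner (cons b D T) (cons a C one) (fun T' => f (N.branchDers label T')) =
      replaceSum (N.nabla (N.covDerList (label a) (N.branchDers label C))) f
        (N.branchDers label (cons b D T)) := by
  have h₁ : sumGraft (cons a C one) D
      (fun D' => N.covDerList (label b) (N.branchDers label D')) =
      N.nabla (N.covDerList (label a) (N.branchDers label C))
        (N.covDerList (label b) (N.branchDers label D)) := by
    rw [sumGraft_planted, hD, branchDers_cons, covDerList_cons, sub_add_cancel]
  let g : Der k R →+ M := AddMonoidHom.mk' (fun y => f (y :: N.branchDers label T))
    fun y z => hf _ [] y z _ rfl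
  have h₂ : sumGraft (cons a C one) D (fun D' => f (N.branchDers label (cons b D' T))) =
      g (sumGraft (cons a C one) D
        fun D' => N.covDerList (label b) (N.branchDers label D')) :=
    (map_listSum g _ _).symm
  rw [sumInner_cons_planted, h₂, h₁, branchDers_cons, replaceSum]
  exact congrArg₂ (· + ·) rfl hT

/-- The hypothesis `hD` of the inductive step is an identity in `Der k R`, whatever the target `M`.
For `M = Der k R` it is the induction hypothesis for `D`; this case is settled first and then
supplies `hD` in general. -/
theorem sumInner_planted_branchDers_der (a : α) (C T : OTree α)
    {f : List (Der k R) → Der k R} (hf : ∀ n, MultiAdditiveAt n f) :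
    sumInner T (cons a C one) (fun T' => f (N.branchDers label T')) =
      replaceSum (N.nabla (N.covDerList (label a) (N.branchDers label C))) f
        (N.branchDers label T) := by
  induction T generalizing f with
  | one => exact sumInner_one_cons _ _ _ _
  | cons b D T hD hT =>
    exact N.sumInner_cons_planted_branchDers label a C b D T hf
      (hD (N.multiAdditive_covDerList (label b))) (hT fun n => (hf (n + 1)).cons _)

/-- Linking a tree whose root has one child to the nodes of `T` other than the root amounts to
the covariant differentiation of the entries of `branchDers label T`. -/
theorem sumInner_planted_branchDers {M : Type*} [AddCommGroup M] (a : α) (C T : OTree α)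
    {f : List (Der k R) → M} (hf : ∀ n, MultiAdditiveAt n f) :
    sumInner T (cons a C one) (fun T' => f (N.branchDers label T')) =
      replaceSum (N.nabla (N.covDerList (label a) (N.branchDers label C))) f
        (N.branchDers label T) := by
  induction T generalizing f with
  | one => exact sumInner_one_cons _ _ _ _
  | cons b D T _ hT =>
    exact N.sumInner_cons_planted_branchDers label a C b D T hf
      (N.sumInner_planted_branchDers_der label a C D (N.multiAdditive_covDerList (label b)))
      (hT fun n => (hf (n + 1)).cons _)

theorem treeOp_planted (a : α) (C : OTree α) : N.treeOp label (cons a C one) =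
    iota (N.covDerList (label a) (N.branchDers label C)) :=
  (N.covOpList_cons _ []).trans ((sub_zero _).trans (mul_one _))

/-- The terms subtracted in the recursion for `covOp` are exactly the operators of the trees in
which the planted tree is linked off the root of `T`. -/
theorem treeOp_planted_mul (a : α) (C T : OTree α) :
    N.treeOp label (cons a C T) + sumInner T (cons a C one) (N.treeOp label) =
      N.treeOp label (cons a C one) * N.treeOp label T := by
  rw [treeOp_planted]
  have h₁ : sumInner T (cons a C one) (N.treeOp label) = _ :=
    N.sumInner_planted_branchDers label a C T N.multiAdditive_covOpList
  have h₂ : N.treeOp label (cons a C T) = _ :=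
    N.covOpList_cons (N.covDerList (label a) (N.branchDers label C)) (N.branchDers label T)
  rw [h₁, h₂, sub_add_cancel]; rfl

end

/-! ### The bialgebra homomorphism of a connection and the subalgebras containing its image -/

variable (S S' : Set (Der k R))

theorem treeMap_ofTree (T : OTree S) :
    N.treeMap S (TreeAlgebra.ofTree T : TreeAlgebra k S) = N.treeOp Subtype.val T :=
  (Finsupp.linearCombination_single k (1 : k) T).trans (one_smul _ _)

/-- `treeMapTo`, as a map on the algebra of trees. -/
def treeHom (h : ∀ x, N.treeMap S x ∈ Diff S') : TreeAlgebra k S →ₗ[k] Diff S' :=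
  N.treeMapTo S S' h

theorem coe_treeHom_ofTree (h : ∀ x, N.treeMap S x ∈ Diff S') (T : OTree S) :
    (N.treeHom S S' h (TreeAlgebra.ofTree T) : UDer k R) = N.treeOp Subtype.val T :=
  N.treeMap_ofTree S T

variable {S'} in
theorem isPrimitive_of_coe_eq_iota {x : Diff S'} {E : Der k R} (hx : (x : UDer k R) = iota E) :
    IsPrimitive k x := by
  refine diffInclTensor_injective S' ((diffInclTensor_diffComul S' x).trans ?_)
  rw [hx, uComul_iota]
  simp [diffInclTensor, hx]

theorem isBialgHom_treeMapTo (h : ∀ x, N.treeMap S x ∈ Diff S') :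
    IsBialgHom (treeData k S) (diffData S') (N.treeMapTo S S' h) := by
  refine TreeAlgebra.isBialgHom_of_planted (f := N.treeHom S S' h)
    (Subtype.ext (N.coe_treeHom_ofTree S S' h one)) (fun a C T => Subtype.ext ?_) fun a C =>
      isPrimitive_of_coe_eq_iota
        ((N.coe_treeHom_ofTree S S' h _).trans (N.treeOp_planted _ a C))
  rw [TreeAlgebra.planted_mul, map_add, sumInner, map_listSum, Subalgebra.coe_add,
    Subalgebra.coe_mul, coe_treeHom_ofTree, coe_treeHom_ofTree, coe_treeHom_ofTree]
  refine Eq.trans ?_ (N.treeOp_planted_mul Subtype.val a C T)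
  refine congrArg _ ((map_listSum (Diff S').val _ _).trans ?_)
  exact congrArg _ (funext fun T' => N.coe_treeHom_ofTree S S' h T')

variable {S S'}

theorem nabla_smul_right (c : k) (E F : Der k R) : N.nabla E (c • F) = c • N.nabla E F := by
  have h := N.leibniz (algebraMap k R c) E F
  rwa [Derivation.map_algebraMap, zero_smul, add_zero, algebraMap_smul, algebraMap_smul] at h

theorem nabla_smul_left (c : k) (E F : Der k R) : N.nabla (c • E) F = c • N.nabla E F := by
  have h := N.smul_left (algebraMap k R c) E F
  rwa [algebraMap_smul, algebraMap_smul] at h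

/-- A connection on derivations, as a bilinear map. -/
def nablaHom : Der k R →ₗ[k] Der k R →ₗ[k] Der k R :=
  LinearMap.mk₂ k N.nabla N.add_left N.nabla_smul_left N.add_right N.nabla_smul_right

theorem nabla_mem_span
    (hS : ∀ E ∈ S, ∀ F ∈ S, N.nabla E F ∈ Submodule.span k S) {E F : Der k R}
    (hE : E ∈ Submodule.span k S) (hF : F ∈ Submodule.span k S) :
    N.nabla E F ∈ Submodule.span k S := by
  have h : Submodule.map₂ N.nablaHom (Submodule.span k S) (Submodule.span k S) ≤
      Submodule.span k S := by
    rw [Submodule.map₂_span_span, Submodule.span_le]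
    rintro _ ⟨E, hE, F, hF, rfl⟩
    exact hS E hE F hF
  exact h (Submodule.apply_mem_map₂ N.nablaHom hE hF)

variable {V : Submodule k (Der k R)}

theorem update_nabla_mem (hV : ∀ E ∈ V, ∀ F ∈ V, N.nabla E F ∈ V) {n : ℕ}
    {F : Fin (n + 1) → Der k R} (hF : ∀ i, F i ∈ V) (l i : Fin n) :
    Function.update (Fin.tail F) l (N.nabla (F 0) (Fin.tail F l)) i ∈ V := by
  by_cases h : i = l
  · rw [h, Function.update_self]
    exact hV _ (hF 0) _ (hF l.succ)
  · rw [Function.update_of_ne h]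
    exact hF i.succ

theorem covDer_mem (hV : ∀ E ∈ V, ∀ F ∈ V, N.nabla E F ∈ V) {E : Der k R} (hE : E ∈ V)
    {n : ℕ} {F : Fin n → Der k R} (hF : ∀ i, F i ∈ V) : N.covDer E n F ∈ V := by
  induction n with
  | zero => exact hE
  | succ n ih =>
    exact sub_mem (hV _ (hF 0) _ (ih fun i => hF i.succ))
      (sum_mem fun l _ => ih (N.update_nabla_mem hV hF l))

theorem covOp_mem (hV : ∀ E ∈ V, ∀ F ∈ V, N.nabla E F ∈ V) {A : Subalgebra k (UDer k R)}
    (hA : ∀ E ∈ V, iota E ∈ A) {n : ℕ} {F : Fin n → Der k R} (hF : ∀ i, F i ∈ V) :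
    N.covOp n F ∈ A := by
  induction n with
  | zero => exact one_mem A
  | succ n ih =>
    exact sub_mem (mul_mem (hA _ (hF 0)) (ih fun i => hF i.succ))
      (sum_mem fun l _ => ih (N.update_nabla_mem hV hF l))

theorem mem_of_mem_branchDers (hV : ∀ E ∈ V, ∀ F ∈ V, N.nabla E F ∈ V) {α : Type*}
    {label : α → Der k R} (hl : ∀ a, label a ∈ V) (T : OTree α) :
    ∀ E ∈ N.branchDers label T, E ∈ V := by
  induction T with
  | one => simp [branchDers]
  | cons a C T hC hT =>
    rw [branchDers_cons, List.forall_mem_cons]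
    exact ⟨N.covDer_mem hV (hl a) fun i => hC _ (List.get_mem _ i), hT⟩

/-- By bilinearity the span of `S'` is closed under `∇`. It contains the labels, hence the
derivations of all branches, and the operators are polynomials in these. -/
theorem treeMap_mem_Diff (hSS' : S ⊆ S')
    (hS' : ∀ E ∈ S', ∀ F ∈ S', N.nabla E F ∈ Submodule.span k S') (x : KLT k S) :
    N.treeMap S x ∈ Diff S' := by
  have hV : ∀ E ∈ Submodule.span k S', ∀ F ∈ Submodule.span k S',
      N.nabla E F ∈ Submodule.span k S' := fun E hE F hF => N.nabla_mem_span hS' hE hF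
  have hA : Submodule.span k S' ≤ (Subalgebra.toSubmodule (Diff S')).comap iota :=
    Submodule.span_le.2 fun E hE => iota_mem_Diff hE
  refine TreeAlgebra.induction (p := fun x : TreeAlgebra k S => N.treeMap S x ∈ Diff S')
    (fun x y hx hy => ?_) (fun c x hx => ?_) (fun T => ?_) x
  · exact (map_add (N.treeMap S) x y).symm ▸ add_mem hx hy
  · exact (map_smul (N.treeMap S) c x).symm ▸ Subalgebra.smul_mem _ hx c
  · rw [treeMap_ofTree]
    exact N.covOp_mem hV (fun E hE => hA hE) fun i =>
      N.mem_of_mem_branchDers hV (fun E => Submodule.subset_span (hSS' E.2)) T _ (List.get_mem _ i)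

/-- For `S' = Der k R` the inclusion of the image holds for every connection, so the action can be
pulled back from the natural action of `Diff Set.univ`. -/
theorem isModuleAlgebra_treeAct : IsModuleAlgebra (treeData k S) (N.treeAct S) :=
  have h : ∀ x, N.treeMap S x ∈ Diff (Set.univ : Set (Der k R)) :=
    N.treeMap_mem_Diff (Set.subset_univ S) fun _ _ _ _ => Submodule.subset_span trivial
  (isModuleAlgebra_diffAct Set.univ).comp (N.isBialgHom_treeMapTo S Set.univ h)

end Connection

end TreeHopf

end

/-! ### The theorem -/

open TreeHopf in
theorem theorem4p2 {k : Type*} {R : Type*} [Field k] [CommRing R] [Algebra k R]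
    (S : Set (Derivation k R R)) :
    -- `R # Diff_k(S)` is an `R/k`-Hopf algebra
    IsRkHopfAlgebra (smash (diffData S) (diffAct S)) ∧
    -- `r # h ↦ (s ↦ r (h·s))` is a homomorphism of `R/k`-algebras from `R # Diff_k(S)` to `End_k(R)`;
    -- its image is the subalgebra generated by (the multiplications by elements of) `R` and by `S`,
    -- and the image of `1 # Diff_k(S)` is the `k`-subalgebra generated by `S`
    ((∀ b c, smashToEnd (diffAct S) ((smash (diffData S) (diffAct S)).mul b c) =
        smashToEnd (diffAct S) b * smashToEnd (diffAct S) c) ∧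
      (∀ r : R, smashToEnd (diffAct S) ((smash (diffData S) (diffAct S)).incl r) =
        LinearMap.mulLeft k r) ∧
      LinearMap.range (smashToEnd (diffAct S)) =
        Subalgebra.toSubmodule (Algebra.adjoin k (Set.range (LinearMap.mulLeft k (A := R)) ∪
          (fun E : Derivation k R R => (E : R →ₗ[k] R)) '' S)) ∧
      LinearMap.range (smashToEnd (diffAct S) ∘ₗ TensorProduct.mk k R (Diff S) 1) =
        Subalgebra.toSubmodule (Algebra.adjoin k
          ((fun E : Derivation k R R => (E : R →ₗ[k] R)) '' S : Set (Module.End k R)))) ∧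
    -- `R # k{LT(S)}` is an `R/k`-Hopf algebra
    (∀ act : KLT k S →ₗ[k] Module.End k R, IsModuleAlgebra (treeData k S) act →
      IsRkHopfAlgebra (smash (treeData k S) act)) ∧
    -- there is a bialgebra homomorphism `k{LT(S)} → Diff_k(S)` that sends `v(E)` to `E`
    (∃ φ : KLT k S →ₗ[k] Diff S, IsBialgHom (treeData k S) (diffData S) φ ∧
      ∀ E : S, φ (Finsupp.single (OTree.v E) 1) = ⟨iota E.1, iota_mem_Diff E.2⟩) ∧
    -- every bialgebra homomorphism `k{LT(S)} → Diff_k(S)` induces a module algebra structure on `R`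
    -- and a homomorphism of `R/k`-bialgebras `R # k{LT(S)} → R # Diff_k(S)`
    (∀ φ : KLT k S →ₗ[k] Diff S, IsBialgHom (treeData k S) (diffData S) φ →
      IsModuleAlgebra (treeData k S) (diffAct S ∘ₗ φ) ∧
      IsRkBialgebraHom (smash (treeData k S) (diffAct S ∘ₗ φ)) (smash (diffData S) (diffAct S))
        (φ.baseChange R)) ∧
    -- the map given by a connection
    (∀ N : Connection k R,
      IsModuleAlgebra (treeData k S) (N.treeAct S) ∧
      (∀ (S' : Set (Derivation k R R)) (h : ∀ x, N.treeMap S x ∈ Diff S'),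
        IsBialgHom (treeData k S) (diffData S') (N.treeMapTo S S' h) ∧
        IsRkBialgebraHom (smash (treeData k S) (N.treeAct S)) (smash (diffData S') (diffAct S'))
          ((N.treeMapTo S S' h).baseChange R)) ∧
      (∀ S' : Set (Derivation k R R), S ⊆ S' →
        (∀ E ∈ S', ∀ F ∈ S', N.nabla E F ∈ Submodule.span k S') →
        ∀ x, N.treeMap S x ∈ Diff S')) := by
  refine ⟨?_, ⟨?_, ?_, ?_, ?_⟩, ?_, ?_, ?_, ?_⟩
  -- `BialgData.of` applied to the bialgebra `Diff S` unfolds to `diffData S`, and applied to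
  -- `TreeAlgebra k S` to `treeData k S`, so the general result applies as it stands.
  · exact Smash.isRkHopfAlgebra (H := Diff S) (isModuleAlgebra_diffAct S)
      (adjoin_isPrimitive_diff S)
  · exact smashToEnd_mul (isModuleAlgebra_diffAct S)
  · exact smashToEnd_incl S
  · exact range_smashToEnd S
  · exact range_smashToEnd_comp S
  · exact fun act hact => Smash.isRkHopfAlgebra (H := TreeAlgebra k S) hact
      TreeAlgebra.adjoin_isPrimitive
  · refine ⟨TreeAlgebra.leafHom fun E : S => diffGen E.2,
      TreeAlgebra.isBialgHom_leafHom fun E => diffComul_gen E.2, fun E => ?_⟩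
    exact (TreeAlgebra.leafHom_ofTree _ (OTree.v E)).trans (mul_one _)
  · exact fun φ hφ => ⟨(isModuleAlgebra_diffAct S).comp hφ, hφ.baseChange (diffAct S)⟩
  · intro N
    refine ⟨N.isModuleAlgebra_treeAct, fun S' h => ?_, fun S' => N.treeMap_mem_Diff⟩
    have hN := N.isBialgHom_treeMapTo S S' h
    exact ⟨hN, hN.baseChange (diffAct S')⟩
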